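/- \textbf{Setting.} An intermediary connects one unit-demand buyer with $n$ sellers, each offering a distinct item. The buyer's values $v_i$ and the sellers' private costs $c_i$ are all independent, with distributions on $[0,\infty)$ given by densities $f_i$ (cdf $F_i$) and $g_i$ (cdf $G_i$), each positive exactly on an interval. Each $v_i$ has finite mean and is regular: the virtual value $\phi_i(v)=v-\frac{1-F_i(v)}{f_i(v)}$ is strictly increasing on the support interval (for instance, $v_i$ of finite mean with monotone hazard rate). The distribution of $-c_i$ has a monotone (non-decreasing) hazard rate; let $\theta_i(c)=c+\frac{G_i(c)}{g_i(c)}$ be the virtual cost. Write $\phi_i^{-1}(s)=\inf\{v:\ f_i(v)>0,\ \phi_i(v)\ge s\}$, with $\inf\emptyset=+\infty$. In the full-attention model the buyer sees prices $p_i\in(-\infty,+\infty]$ ($+\infty$ means that the item is not offered) and buys an item maximizing $v_i-p_i$ if this maximum is nonnegative, and nothing otherwise. Let $x_i(p)$ be the probability that he buys item $i$. For item costs $\theta\in\mathbb R^n$, the algorithmic pricing problem is to maximize $\sum_i x_i(p)(p_i-\theta_i)$ over $p$ (a term with $p_i=+\infty$ counts as $0$). The anonymous virtual reserve prices at $\theta$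 are $p_i(\theta)=\phi_i^{-1}(r+\theta_i)$, where $r=r(\theta)\ge 0$ is the (smallest) median of $\max\{0,\max_i(\phi_i(v_i)-\theta_i)\}$. A protocol maps the reported costs to (possibly randomized) buyer prices and expected transfers to the sellers. It is truthful if its expected revenue (the price paid by the buyer minus the transfers) is well defined and finite, reporting the true cost is a dominant strategy for every seller in expectation over the buyer's values and the protocol's randomness, and truthful sellers have nonnegative expected utility. A truthful protocol is an $\alpha$-approximation to the intermediation problem if its expected revenue is at least $\alpha$ times that of every truthful protocol. \textbf{Theorem.} \begin{enumerate} \item For every $\theta\in\mathbb R^n$, the prices $p(\theta)$ achieve at least $\frac12$ of the profit of every price vector $p\in(-\infty,+\infty]^n$ in the algorithmic pricing problem with item costs $\theta$. \item The pricing is monotone for the sellers: $x_i(p(\theta))$ is non-increasing in $\theta_i$ for every $i$, when the other $\theta_j$ are fixed. \item The mechanism that posts the prices $p(\theta_1(c_1),\dots,\theta_n(c_n))$ at reported costs $c$ and, when item $i$ is sold, pays its seller \[ c_i+\frac{1}{x_i(c)}\int_{\{u>c_i:\ g_i(u)>0\}}x_i(u,c_{-i})\,du, \] where $x_i(c)=x_i\big(p(\theta_1(c_1),\dots,\theta_n(c_n))\big)$,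 is truthful and is a $\frac12$-approximation to the intermediation problem. \end{enumerate} -/

import Mathlib

open MeasureTheory

namespace Intermediation

noncomputable section

/-! ### Distributions given by densities -/

/-- `f` is the density of a distribution on `[0, ∞)` which is positive exactly on an interval. -/
structure IsNonnegDensity (f : ℝ → ℝ) : Prop where
  measurable : Measurable f
  nonneg : ∀ z, 0 ≤ f z
  eq_zero_of_neg : ∀ z < 0, f z = 0
  integral_eq_one : ∫ z, f z = 1
  ordConnected : {z | 0 < f z}.OrdConnected

/-- The support interval of a density. -/
def supp (f : ℝ → ℝ) : Set ℝ := {z | 0 < f z}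

/-- The distribution with density `f`. -/
def dist (f : ℝ → ℝ) : Measure ℝ := volume.withDensity fun z => ENNReal.ofReal (f z)

/-- The cumulative distribution function of the distribution with density `f`. -/
def cdf (f : ℝ → ℝ) (z : ℝ) : ℝ := ∫ t in Set.Iic z, f t

/-- The hazard rate `f / (1 - F)`. -/
def hazardRate (f : ℝ → ℝ) (z : ℝ) : ℝ := f z / (1 - cdf f z)

/-- Monotone hazard rate: the hazard rate is non-decreasing (where it is defined). -/
def HasMHR (f : ℝ → ℝ) : Prop := MonotoneOn (hazardRate f) {z | cdf f z < 1}

/-- Myerson's virtual value `φ(v) = v - (1 - F(v)) / f(v)`. -/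
def virtualValue (f : ℝ → ℝ) (v : ℝ) : ℝ := v - (1 - cdf f v) / f v

/-- The virtual cost `θ(c) = c + F(c) / f(c)`. -/
def virtualCost (g : ℝ → ℝ) (c : ℝ) : ℝ := c + cdf g c / g c

/-- The inverse `φ⁻¹(s)` of the virtual value function: the smallest value in the support interval
at which the virtual value reaches `s`; it is `⊤` (the item cannot be sold) if there is none. -/
def virtualValueInv (f : ℝ → ℝ) (s : ℝ) : EReal :=
  sInf ((fun v : ℝ => (v : EReal)) '' {v | v ∈ supp f ∧ s ≤ virtualValue f v})

/-- The joint law of independent variables with densities `f i`. -/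
def jointDist {n : ℕ} (f : Fin n → ℝ → ℝ) : Measure (Fin n → ℝ) := Measure.pi fun i => dist (f i)

/-! ### The full-attention buyer and the algorithmic pricing problem -/

/-- Facing prices `p` (where `⊤` means that the item is not offered), the unit-demand buyer with
values `v` buys item `i`: it has non-negative surplus and maximizes the surplus over all items.
Ties, which have probability zero for values with densities, go to the smallest index. -/
def Buys {n : ℕ} (p : Fin n → EReal) (v : Fin n → ℝ) (i : Fin n) : Prop :=
  0 ≤ (v i : EReal) - p i ∧
  (∀ j, (v j : EReal) - p j ≤ (v i : EReal) - p i) ∧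
  ∀ j < i, (v j : EReal) - p j < (v i : EReal) - p i

/-- The probability that item `i` is bought at prices `p`. -/
def saleProb {n : ℕ} (f : Fin n → ℝ → ℝ) (p : Fin n → EReal) (i : Fin n) : ℝ :=
  (jointDist f).real {v | Buys p v i}

/-- The expected profit of posting the prices `p` when the sale of item `i` costs `θ i`: the
objective of the algorithmic pricing problem. -/
def pricingProfit {n : ℕ} (f : Fin n → ℝ → ℝ) (θ : Fin n → ℝ) (p : Fin n → EReal) : ℝ :=
  ∑ i, saleProb f p i * ((p i).toReal - θ i)

/-- The anonymous virtual reserve at costs `θ`: the median of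
`max (0, max_i (φ_i(v_i) - θ_i))`. -/
def virtualReserve {n : ℕ} (f : Fin n → ℝ → ℝ) (θ : Fin n → ℝ) : ℝ :=
  sInf {t : ℝ | 1 / 2 ≤
    (jointDist f).real {v | (⨆ i, max 0 (virtualValue (f i) (v i) - θ i)) ≤ t}}

/-- The prices of the anonymous virtual reserve `r` at costs `θ`: item `i` gets the price at which
its virtual value, net of its cost `θ i`, equals `r`. -/
def reservePrices {n : ℕ} (f : Fin n → ℝ → ℝ) (θ : Fin n → ℝ) (i : Fin n) : EReal :=
  virtualValueInv (f i) (virtualReserve f θ + θ i)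

/-! ### The intermediation problem -/

/-- An intermediation protocol for a full-attention buyer: from the reported costs `c` and a random
seed `ω`, uniform on `[0, 1]`, it computes the prices shown to the buyer, and it makes a transfer,
in expectation `pay c i`, to each seller `i`. -/
structure Protocol (n : ℕ) where
  price : unitInterval → (Fin n → ℝ) → Fin n → EReal
  pay : (Fin n → ℝ) → Fin n → ℝ

/-- The probability that item `i` is sold when the reported costs are `c`. -/
def Protocol.alloc {n : ℕ} (M : Protocol n) (f : Fin n → ℝ → ℝ) (c : Fin n → ℝ) (i : Fin n) : ℝ :=
  ((volume : Measure unitInterval).prod (jointDist f)).real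
    {q | Buys (M.price q.1 c) q.2 i}

open Classical in
/-- The intermediary's profit at seed `ω`, buyer values `v` and costs `c`: the price paid by the
buyer minus the transfers to the sellers. -/
def Protocol.profit {n : ℕ} (M : Protocol n) (q : unitInterval × (Fin n → ℝ) × (Fin n → ℝ)) : ℝ :=
  (∑ i, if Buys (M.price q.1 q.2.2) q.2.1 i then (M.price q.1 q.2.2 i).toReal else 0) -
    ∑ i, M.pay q.2.2 i

/-- The joint law of seed, buyer values (densities `f`) and costs (densities `g`). -/
def outcomeDist {n : ℕ} (f g : Fin n → ℝ → ℝ) :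
    Measure (unitInterval × (Fin n → ℝ) × (Fin n → ℝ)) :=
  (volume : Measure unitInterval).prod ((jointDist f).prod (jointDist g))

/-- The expected revenue of the intermediary when the sellers report their true costs. -/
def Protocol.revenue {n : ℕ} (M : Protocol n) (f g : Fin n → ℝ → ℝ) : ℝ :=
  ∫ q, M.profit q ∂outcomeDist f g

/-- The expected utility of seller `i` with true cost `c` when the reported costs are `b`. -/
def Protocol.sellerUtility {n : ℕ} (M : Protocol n) (f : Fin n → ℝ → ℝ) (i : Fin n) (c : ℝ)
    (b : Fin n → ℝ) : ℝ :=
  M.pay b i - M.alloc f b i * c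

/-- Truthful protocols: measurable with finite expected revenue, no price is `-∞`, reporting the
true cost is a dominant strategy for each seller, and truthful sellers do not lose by
participating. -/
structure Protocol.IsTruthful {n : ℕ} (M : Protocol n) (f g : Fin n → ℝ → ℝ) : Prop where
  measurable_price : Measurable fun q : unitInterval × (Fin n → ℝ) => M.price q.1 q.2
  measurable_pay : Measurable M.pay
  price_ne_bot : ∀ ω c i, M.price ω c i ≠ ⊥
  integrable_profit : Integrable M.profit (outcomeDist f g)
  dominant : ∀ c : Fin n → ℝ, (∀ j, c j ∈ supp (g j)) → ∀ i, ∀ b ∈ supp (g i),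
    M.sellerUtility f i (c i) (Function.update c i b) ≤ M.sellerUtility f i (c i) c
  participation : ∀ c : Fin n → ℝ, (∀ j, c j ∈ supp (g j)) → ∀ i,
    0 ≤ M.sellerUtility f i (c i) c

/-- `M` is an `α`-approximation to the intermediation problem: it is truthful, and its revenue is at
least `α` times the revenue of every truthful protocol. -/
def Protocol.IsApproximation {n : ℕ} (M : Protocol n) (f g : Fin n → ℝ → ℝ) (α : ℝ) : Prop :=
  M.IsTruthful f g ∧ ∀ M' : Protocol n, M'.IsTruthful f g → α * M'.revenue f g ≤ M.revenue f g

/-- The buyer prices of the anonymous virtual reserve mechanism at reported costs `c`. -/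
def mechPrices {n : ℕ} (f g : Fin n → ℝ → ℝ) (c : Fin n → ℝ) : Fin n → EReal :=
  reservePrices f fun i => virtualCost (g i) (c i)

/-- What the mechanism pays to seller `i` if item `i` is bought:
`c_i + (∫_{u > c_i} x_i(u, c_{-i}) du) / x_i(c)`, with `x_i` the probability of sale and `u` ranging
over the support of the cost of seller `i`. -/
def sellerPrice {n : ℕ} (f g : Fin n → ℝ → ℝ) (c : Fin n → ℝ) (i : Fin n) : ℝ :=
  c i + (∫ u in supp (g i) ∩ Set.Ioi (c i),
    saleProb f (mechPrices f g (Function.update c i u)) i) / saleProb f (mechPrices f g c) i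

/-- The anonymous virtual reserve mechanism: post the anonymous virtual reserve prices for the
virtual costs `θ_i(c_i)`, and pay the seller of the item that is bought. -/
def reserveMechanism {n : ℕ} (f g : Fin n → ℝ → ℝ) : Protocol n where
  price _ c := mechPrices f g c
  pay c i := saleProb f (mechPrices f g c) i * sellerPrice f g c i

end

end Intermediation

namespace Intermediation

open Set Filter Topology

/-! ### Distributions given by densities -/

section Density

variable {f : ℝ → ℝ}

/-! Pricing. Fix `r ≥ 0` and split each margin as `p_i - θ_i = r + (p_i - θ_i - r)`. The buyer takes
at most one item, so the first parts earn at most `r` in total. With the other values fixed, the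
values `v_i` at which item `i` is bought form an upper set above `p_i`. By Myerson's argument the
price collected there is at most the virtual value, so the second part earns at most `E max(0, φ_i -
θ_i - r)`. This bounds every price vector (`pricingProfit_le`). Taking `r` to be the median recovers
half of each part. If `r > 0`, some item is sold with probability at least 1/2. All items other than
`i` are priced out with probability at least 1/2, independently of `v_i`, so `i` is sold at least
half as often as it would be alone, and alone the price `φ_i⁻¹(r + θ_i)` earns the whole expected
excess (`le_pricingProfit_reservePrices`). Strict regularity makes the virtual values atomless, so
the median splits the probability exactly.

Monotonicity. When `θ_i` rises, `r` falls, but by no more than `θ_i` rises. Hence `r + θ_i` and the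
price of `i` go up while all other prices go down, and `i` is sold less often
(`saleProb_update_le`).

Intermediation. Dominant-strategy truthfulness and participation force the transfer to a seller to
cover his cost plus the rent `∫_{u > c_i} x_i(u, c_{-i}) du`. By Fubini the expected rent is the
expectation of `x_i G_i / g_i`, so expected transfers are at least the expected virtual costs of the
items sold (`Protocol.IsTruthful.virtualCost_le_pay`). The mechanism pays no more than this
(`reserveMechanism_pay_le_virtualCost`), and it is truthful because the sale probability is
non-increasing in the virtual cost, which is monotone by the hazard rate condition. Revenues are
thus compared through pricing profits at the virtual costs, where the pricing bound applies for each
seed and cost vector. -/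

lemma IsNonnegDensity.integrable (hf : IsNonnegDensity f) : Integrable f := by
  by_contra h
  have := hf.integral_eq_one
  rw [integral_undef h] at this
  exact zero_ne_one this

lemma IsNonnegDensity.isProbabilityMeasure (hf : IsNonnegDensity f) :
    IsProbabilityMeasure (dist f) := by
  constructor
  rw [dist, withDensity_apply _ MeasurableSet.univ, Measure.restrict_univ,
    ← ofReal_integral_eq_lintegral_ofReal hf.integrable (ae_of_all _ hf.nonneg),
    hf.integral_eq_one, ENNReal.ofReal_one]

lemma dist_absolutelyContinuous : dist f ≪ volume := withDensity_absolutelyContinuous _ _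

lemma noAtoms_dist : NullSingletonClass (dist f) :=
  ⟨fun x => dist_absolutelyContinuous (measure_singleton x)⟩

lemma IsNonnegDensity.measurableSet_supp (hf : IsNonnegDensity f) : MeasurableSet (supp f) :=
  measurableSet_lt measurable_const hf.measurable

lemma IsNonnegDensity.nonneg_of_mem_supp (hf : IsNonnegDensity f) {z : ℝ} (hz : z ∈ supp f) :
    0 ≤ z := by
  by_contra h
  exact (hf.eq_zero_of_neg z (not_le.1 h)).not_gt hz

lemma IsNonnegDensity.ae_mem_supp (hf : IsNonnegDensity f) : ∀ᵐ z ∂dist f, z ∈ supp f := by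
  rw [dist, ae_withDensity_iff hf.measurable.ennreal_ofReal]
  refine ae_of_all _ fun z hz => ?_
  simpa [supp] using hz

lemma IsNonnegDensity.ae_nonneg (hf : IsNonnegDensity f) : ∀ᵐ z ∂dist f, 0 ≤ z :=
  hf.ae_mem_supp.mono fun _ => hf.nonneg_of_mem_supp

lemma IsNonnegDensity.cdf_eq (hf : IsNonnegDensity f) (z : ℝ) :
    cdf f z = (dist f).real (Iic z) := by
  rw [cdf, measureReal_def, dist, withDensity_apply _ measurableSet_Iic,
    integral_eq_lintegral_of_nonneg_ae (ae_of_all _ hf.nonneg) hf.measurable.aestronglyMeasurable]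

lemma IsNonnegDensity.cdf_eq_Iio (hf : IsNonnegDensity f) (z : ℝ) :
    cdf f z = (dist f).real (Iio z) := by
  have := noAtoms_dist (f := f)
  rw [hf.cdf_eq, measureReal_congr Iio_ae_eq_Iic]

lemma IsNonnegDensity.one_sub_cdf_eq (hf : IsNonnegDensity f) (z : ℝ) :
    1 - cdf f z = (dist f).real (Ioi z) := by
  have := hf.isProbabilityMeasure
  rw [hf.cdf_eq, ← probReal_compl_eq_one_sub measurableSet_Iic, compl_Iic]

lemma IsNonnegDensity.cdf_nonneg (hf : IsNonnegDensity f) (z : ℝ) : 0 ≤ cdf f z := by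
  rw [hf.cdf_eq]; exact measureReal_nonneg

lemma IsNonnegDensity.cdf_le_one (hf : IsNonnegDensity f) (z : ℝ) : cdf f z ≤ 1 := by
  have := hf.isProbabilityMeasure
  rw [hf.cdf_eq]; exact measureReal_le_one

lemma IsNonnegDensity.monotone_cdf (hf : IsNonnegDensity f) : Monotone (cdf f) := by
  have := hf.isProbabilityMeasure
  intro a b hab
  rw [hf.cdf_eq, hf.cdf_eq]
  exact measureReal_mono (Iic_subset_Iic.2 hab)

lemma IsNonnegDensity.measurable_virtualValue (hf : IsNonnegDensity f) :
    Measurable (virtualValue f) :=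
  measurable_id.sub ((measurable_const.sub hf.monotone_cdf.measurable).div hf.measurable)

lemma IsNonnegDensity.measurable_virtualCost (hf : IsNonnegDensity f) :
    Measurable (virtualCost f) :=
  measurable_id.add (hf.monotone_cdf.measurable.div hf.measurable)

lemma IsNonnegDensity.virtualValue_le (hf : IsNonnegDensity f) (v : ℝ) : virtualValue f v ≤ v :=
  sub_le_self _ (div_nonneg (sub_nonneg.2 (hf.cdf_le_one v)) (hf.nonneg v))

lemma IsNonnegDensity.le_virtualCost (hf : IsNonnegDensity f) (c : ℝ) : c ≤ virtualCost f c :=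
  le_add_of_nonneg_right (div_nonneg (hf.cdf_nonneg c) (hf.nonneg c))

lemma IsNonnegDensity.integrable_id (hf : IsNonnegDensity f)
    (hmean : Integrable fun z => z * f z) : Integrable (fun z => z) (dist f) := by
  rw [dist, integrable_withDensity_iff hf.measurable.ennreal_ofReal (by simp)]
  simpa [ENNReal.toReal_ofReal (hf.nonneg _)] using hmean

/-- Exchanging the order of integration against a density: the ratio of a probability to the
density integrates to a length. -/
lemma IsNonnegDensity.lintegral_ratio (hf : IsNonnegDensity f) {R : Set (ℝ × ℝ)}
    (hR : MeasurableSet R) {h : ℝ → ENNReal} (hh : Measurable h) :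
    ∫⁻ u, ENNReal.ofReal ((dist f).real {v | (u, v) ∈ R} / f u) * h u ∂dist f =
      ∫⁻ v, (∫⁻ u in supp f ∩ {u | (u, v) ∈ R}, h u) ∂dist f := by
  have := hf.isProbabilityMeasure
  have hm : Measurable fun u => dist f {v | (u, v) ∈ R} := measurable_measure_prodMk_left hR
  have hm' : Measurable fun u => (dist f).real {v | (u, v) ∈ R} := hm.ennreal_toReal
  have hsR : ∀ v, MeasurableSet {u | (u, v) ∈ R} := fun v => measurable_prodMk_right hR
  have hsL : ∀ u, MeasurableSet {v | (u, v) ∈ R} := fun u => measurable_prodMk_left hR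
  calc ∫⁻ u, ENNReal.ofReal ((dist f).real {v | (u, v) ∈ R} / f u) * h u ∂dist f
      = ∫⁻ u, ENNReal.ofReal (f u) *
          (ENNReal.ofReal ((dist f).real {v | (u, v) ∈ R} / f u) * h u) := by
        conv_lhs => rw [dist]
        exact lintegral_withDensity_eq_lintegral_mul _ hf.measurable.ennreal_ofReal
          ((hm'.div hf.measurable).ennreal_ofReal.mul hh)
    _ = ∫⁻ u in supp f, (∫⁻ v, {v | (u, v) ∈ R}.indicator (fun _ => h u) v ∂dist f) := by
        rw [← lintegral_indicator hf.measurableSet_supp]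
        refine lintegral_congr fun u => ?_
        by_cases hu : u ∈ supp f
        · rw [indicator_of_mem hu, lintegral_indicator_const (hsL u), ← mul_assoc,
            ← ENNReal.ofReal_mul (hf.nonneg u), mul_div_cancel₀ _ (ne_of_gt hu),
            ofReal_measureReal, mul_comm]
        · have : f u = 0 := le_antisymm (not_lt.1 hu) (hf.nonneg u)
          rw [indicator_of_notMem hu, this]; simp
    _ = ∫⁻ v, (∫⁻ u in supp f, {v | (u, v) ∈ R}.indicator (fun _ => h u) v) ∂dist f := by
        apply lintegral_lintegral_swap
        exact (Measurable.indicator (hh.comp measurable_fst) hR).aemeasurable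
    _ = ∫⁻ v, (∫⁻ u in supp f ∩ {u | (u, v) ∈ R}, h u) ∂dist f := by
        refine lintegral_congr fun v => ?_
        rw [inter_comm, ← Measure.restrict_restrict (hsR v), ← lintegral_indicator (hsR v)]
        rfl

lemma IsNonnegDensity.lintegral_survival_ratio (hf : IsNonnegDensity f) {h : ℝ → ENNReal}
    (hh : Measurable h) :
    ∫⁻ u, ENNReal.ofReal ((1 - cdf f u) / f u) * h u ∂dist f =
      ∫⁻ v, (∫⁻ u in supp f ∩ Iio v, h u) ∂dist f := by
  have := hf.lintegral_ratio (R := {q | q.1 < q.2})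
    (measurableSet_lt measurable_fst measurable_snd) hh
  simp only [mem_ofPred_eq] at this
  simp only [hf.one_sub_cdf_eq]
  exact this

lemma IsNonnegDensity.lintegral_cdf_ratio (hf : IsNonnegDensity f) {h : ℝ → ENNReal}
    (hh : Measurable h) :
    ∫⁻ u, ENNReal.ofReal (cdf f u / f u) * h u ∂dist f =
      ∫⁻ v, (∫⁻ u in supp f ∩ Ioi v, h u) ∂dist f := by
  have := hf.lintegral_ratio (R := {q | q.2 < q.1})
    (measurableSet_lt measurable_snd measurable_fst) hh
  simp only [mem_ofPred_eq] at this
  simp only [hf.cdf_eq_Iio]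
  exact this

lemma IsNonnegDensity.integrable_survival_ratio (hf : IsNonnegDensity f)
    (hmean : Integrable fun z => z * f z) :
    Integrable (fun u => (1 - cdf f u) / f u) (dist f) := by
  have h0 : ∀ u, 0 ≤ (1 - cdf f u) / f u := fun u =>
    div_nonneg (sub_nonneg.2 (hf.cdf_le_one u)) (hf.nonneg u)
  refine ⟨((measurable_const.sub hf.monotone_cdf.measurable).div
    hf.measurable).aestronglyMeasurable, ?_⟩
  rw [hasFiniteIntegral_iff_ofReal (ae_of_all _ h0)]
  have h1 := hf.lintegral_survival_ratio (h := 1) measurable_one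
  simp only [Pi.one_apply, mul_one, setLIntegral_one] at h1
  rw [h1]
  refine lt_of_le_of_lt (lintegral_mono_ae ?_)
    ((hasFiniteIntegral_iff_ofReal hf.ae_nonneg).1 (hf.integrable_id hmean).2)
  refine ae_of_all _ fun v => ?_
  calc volume (supp f ∩ Iio v) ≤ volume (Ico 0 v) :=
        measure_mono fun u hu => ⟨hf.nonneg_of_mem_supp hu.1, hu.2⟩
    _ = ENNReal.ofReal v := by simp

lemma IsNonnegDensity.integrable_virtualValue (hf : IsNonnegDensity f)
    (hmean : Integrable fun z => z * f z) : Integrable (virtualValue f) (dist f) :=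
  (hf.integrable_id hmean).sub (hf.integrable_survival_ratio hmean)

/-- Fubini turns the information rent `(1 - F) / f` on `S` into the expected length of the part of
`S` in the support below `v`. The two halves of Myerson's lemma estimate this length: from above for
any upper set, from below only where the support has no gap above the price. -/
lemma IsNonnegDensity.integral_virtualValue_indicator (hf : IsNonnegDensity f)
    (hmean : Integrable fun z => z * f z) {S : Set ℝ} (hS : MeasurableSet S) :
    ∫ v in S, virtualValue f v ∂dist f =
      ∫ v in S, v ∂dist f - (∫⁻ v, volume (supp f ∩ Iio v ∩ S) ∂dist f).toReal := by
  have h0 : ∀ u, 0 ≤ (1 - cdf f u) / f u := fun u =>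
    div_nonneg (sub_nonneg.2 (hf.cdf_le_one u)) (hf.nonneg u)
  have hi := (hf.integrable_survival_ratio hmean)
  have h1 := hf.lintegral_survival_ratio (h := S.indicator 1) (measurable_one.indicator hS)
  simp only [virtualValue]
  rw [integral_sub (hf.integrable_id hmean).integrableOn hi.integrableOn]
  congr 1
  rw [integral_eq_lintegral_of_nonneg_ae (ae_of_all _ h0) hi.1.restrict]
  congr 1
  have h2 : ∫⁻ u, ENNReal.ofReal ((1 - cdf f u) / f u) * S.indicator 1 u ∂dist f =
      ∫⁻ u in S, ENNReal.ofReal ((1 - cdf f u) / f u) ∂dist f := by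
    rw [← lintegral_indicator hS]
    refine lintegral_congr fun u => ?_
    by_cases hu : u ∈ S <;> simp [hu]
  rw [← h2, h1]
  refine lintegral_congr fun v => ?_
  rw [lintegral_indicator_one hS, Measure.restrict_apply hS, inter_comm]

/-- Myerson's bound: selling to an upper set of values at a price below all of them earns at most
the virtual value. -/
lemma IsNonnegDensity.price_mul_le (hf : IsNonnegDensity f)
    (hmean : Integrable fun z => z * f z) {S : Set ℝ} (hS : MeasurableSet S) (hup : IsUpperSet S)
    {p : ℝ} (hp : ∀ v ∈ S, p ≤ v) :
    p * (dist f).real S ≤ ∫ v in S, virtualValue f v ∂dist f := by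
  have := hf.isProbabilityMeasure
  have hi := (hf.integrable_id hmean).integrableOn (s := S)
  have hi2 : IntegrableOn (fun v => v - p) S (dist f) := hi.sub (integrable_const p)
  rw [hf.integral_virtualValue_indicator hmean hS]
  have h1 : (∫⁻ v, volume (supp f ∩ Iio v ∩ S) ∂dist f) ≤
      ENNReal.ofReal (∫ v in S, (v - p) ∂dist f) := by
    rw [ofReal_integral_eq_lintegral_ofReal hi2
      ((ae_restrict_iff' hS).2 (ae_of_all _ fun v hv => sub_nonneg.2 (hp v hv))),
      ← lintegral_indicator hS]
    refine lintegral_mono fun v => ?_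
    by_cases hv : v ∈ S
    · rw [indicator_of_mem hv, ← Real.volume_Ico]
      exact measure_mono fun u hu => ⟨hp u hu.2, hu.1.2⟩
    · have : supp f ∩ Iio v ∩ S = ∅ := by
        ext u
        simp only [mem_inter_iff, mem_Iio, mem_empty_iff_false, iff_false]
        rintro ⟨⟨_, h⟩, h'⟩
        exact hv (hup h.le h')
      simp [this]
  have h2 := ENNReal.toReal_le_of_le_ofReal (setIntegral_nonneg hS
    fun v hv => sub_nonneg.2 (hp v hv)) h1
  have h3 : ∫ v in S, (v - p) ∂dist f = ∫ v in S, v ∂dist f - p * (dist f).real S := by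
    rw [integral_sub hi (integrable_const p)]
    simp [mul_comm]
  linarith

/-- Myerson's lemma: the revenue of a price in the closed support interval is the expected virtual
value sold. -/
lemma IsNonnegDensity.integral_virtualValue_Ici_le (hf : IsNonnegDensity f)
    (hmean : Integrable fun z => z * f z) {p : ℝ} (hp : ∀ v ∈ supp f, p < v → Ioo p v ⊆ supp f) :
    ∫ v in Ici p, virtualValue f v ∂dist f ≤ p * (dist f).real (Ici p) := by
  have := hf.isProbabilityMeasure
  have hS : MeasurableSet (Ici p) := measurableSet_Ici
  have hi := (hf.integrable_id hmean).integrableOn (s := Ici p)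
  have hi2 : IntegrableOn (fun v => v - p) (Ici p) (dist f) := hi.sub (integrable_const p)
  rw [hf.integral_virtualValue_indicator hmean hS]
  have h0 : (∫⁻ v, volume (supp f ∩ Iio v ∩ Ici p) ∂dist f) ≠ ⊤ := by
    refine ne_top_of_le_ne_top ((hasFiniteIntegral_iff_ofReal hf.ae_nonneg).1
      (hf.integrable_id hmean).2).ne (lintegral_mono fun v => ?_)
    calc volume (supp f ∩ Iio v ∩ Ici p) ≤ volume (Ico 0 v) :=
          measure_mono fun u hu => ⟨hf.nonneg_of_mem_supp hu.1.1, hu.1.2⟩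
      _ = ENNReal.ofReal v := by simp
  have h1 : ENNReal.ofReal (∫ v in Ici p, (v - p) ∂dist f) ≤
      ∫⁻ v, volume (supp f ∩ Iio v ∩ Ici p) ∂dist f := by
    rw [ofReal_integral_eq_lintegral_ofReal hi2
      ((ae_restrict_iff' hS).2 (ae_of_all _ fun v hv => sub_nonneg.2 hv)),
      ← lintegral_indicator hS]
    refine lintegral_mono_ae (hf.ae_mem_supp.mono fun v hvs => ?_)
    rcases lt_or_ge p v with hv | hv
    · rw [indicator_of_mem (mem_Ici.2 hv.le), ← Real.volume_Ioo]
      exact measure_mono fun u hu => ⟨⟨hp v hvs hv hu, hu.2⟩, hu.1.le⟩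
    · rcases hv.eq_or_lt with rfl | hv
      · simp
      · rw [indicator_of_notMem (by simpa using hv)]; exact zero_le
  have h2 := (ENNReal.ofReal_le_iff_le_toReal h0).1 h1
  have h3 : ∫ v in Ici p, (v - p) ∂dist f =
      ∫ v in Ici p, v ∂dist f - p * (dist f).real (Ici p) := by
    rw [integral_sub hi (integrable_const p)]
    simp [mul_comm]
  linarith

end Density

/-! ### The inverse of the virtual value -/

section Inverse

variable {f : ℝ → ℝ} {s : ℝ} {v : ℝ}

lemma virtualValueInv_le (hv : v ∈ supp f) (h : s ≤ virtualValue f v) :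
    virtualValueInv f s ≤ v :=
  sInf_le ⟨v, ⟨hv, h⟩, rfl⟩

lemma le_virtualValueInv (hreg : StrictMonoOn (virtualValue f) (supp f)) (hv : v ∈ supp f)
    (h : virtualValue f v < s) : (v : EReal) ≤ virtualValueInv f s := by
  refine le_sInf ?_
  rintro _ ⟨w, ⟨hw, hsw⟩, rfl⟩
  exact EReal.coe_le_coe_iff.2 ((hreg.lt_iff_lt hv hw).1 (h.trans_le hsw)).le

lemma monotone_virtualValueInv : Monotone (virtualValueInv f) := fun _ _ hab =>
  sInf_le_sInf (image_mono fun _ hv => ⟨hv.1, hab.trans hv.2⟩)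

/-- Virtual values never exceed values. Consequently reserve prices leave a margin of at least `r`
over the item cost. -/
lemma IsNonnegDensity.le_virtualValueInv_self (hf : IsNonnegDensity f) (s : ℝ) :
    (s : EReal) ≤ virtualValueInv f s := by
  refine le_sInf ?_
  rintro _ ⟨w, ⟨_, hsw⟩, rfl⟩
  exact EReal.coe_le_coe_iff.2 (hsw.trans (hf.virtualValue_le w))

lemma IsNonnegDensity.virtualValueInv_nonneg (hf : IsNonnegDensity f) (s : ℝ) :
    0 ≤ virtualValueInv f s := by
  refine le_sInf ?_
  rintro _ ⟨w, ⟨hw, _⟩, rfl⟩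
  exact EReal.coe_nonneg.2 (hf.nonneg_of_mem_supp hw)

/-- The support contains points arbitrarily close to the infimum from above, so being an interval it
has no gap between the price and a value. This is the hypothesis of `integral_virtualValue_Ici_le`.
-/
lemma IsNonnegDensity.Ioo_subset_supp (hf : IsNonnegDensity f) {p : ℝ}
    (hp : virtualValueInv f s = p) (hv : v ∈ supp f) : Ioo p v ⊆ supp f := by
  intro u hu
  have h : virtualValueInv f s < u := by rw [hp]; exact EReal.coe_lt_coe_iff.2 hu.1
  obtain ⟨_, ⟨w, ⟨hw, _⟩, rfl⟩, hwu⟩ := sInf_lt_iff.1 h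
  exact hf.ordConnected.out hw hv ⟨(EReal.coe_lt_coe_iff.1 hwu).le, hu.2.le⟩

lemma IsNonnegDensity.measure_virtualValue_eq (hf : IsNonnegDensity f)
    (hreg : StrictMonoOn (virtualValue f) (supp f)) (s : ℝ) :
    dist f {v | virtualValue f v = s} = 0 := by
  have := noAtoms_dist (f := f)
  have h1 : (supp f ∩ {v | virtualValue f v = s}).Subsingleton := fun a ha b hb =>
    hreg.injOn ha.1 hb.1 (ha.2.trans hb.2.symm)
  have h2 := h1.measure_zero (dist f)
  refine le_antisymm ((measure_mono_ae ?_).trans h2.le) zero_le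
  filter_upwards [hf.ae_mem_supp] with v hv h using ⟨hv, h⟩

/-- Translates price events into virtual value events. The virtual value may jump over `s`, so
nothing is inverted exactly; strict monotonicity leaves only null exceptions, namely the complement
of the support, the point where `φ = s` and the price itself. -/
lemma IsNonnegDensity.ae_lt_virtualValueInv_iff (hf : IsNonnegDensity f)
    (hreg : StrictMonoOn (virtualValue f) (supp f)) (s : ℝ) :
    ∀ᵐ v : ℝ ∂dist f, (v : EReal) < virtualValueInv f s ↔ virtualValue f v ≤ s := by
  have := noAtoms_dist (f := f)
  have h1 : ∀ᵐ v ∂dist f, virtualValue f v ≠ s := by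
    simpa [ae_iff] using hf.measure_virtualValue_eq hreg s
  have h2 : {v : ℝ | (v : EReal) = virtualValueInv f s}.Subsingleton := fun a ha b hb =>
    EReal.coe_injective (Eq.trans ha (Eq.symm hb))
  have h3 : ∀ᵐ v : ℝ ∂dist f, (v : EReal) ≠ virtualValueInv f s := by
    simpa [ae_iff] using h2.measure_zero (dist f)
  filter_upwards [hf.ae_mem_supp, h1, h3] with v hv h1 h3
  refine ⟨fun h => ?_, fun h => (le_virtualValueInv hreg hv (lt_of_le_of_ne h h1)).lt_of_ne h3⟩
  by_contra h'
  exact (virtualValueInv_le hv (not_le.1 h').le).not_gt h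

lemma IsNonnegDensity.measureReal_lt_virtualValueInv (hf : IsNonnegDensity f)
    (hreg : StrictMonoOn (virtualValue f) (supp f)) (s : ℝ) :
    (dist f).real {v : ℝ | (v : EReal) < virtualValueInv f s} =
      (dist f).real {v | virtualValue f v ≤ s} :=
  measureReal_congr ((hf.ae_lt_virtualValueInv_iff hreg s).mono fun _ h => propext h)

/-- The expected excess of the virtual value over `s` is at most the revenue of the price
`φ⁻¹(s)` net of a cost `s`. -/
lemma IsNonnegDensity.integral_excess_le (hf : IsNonnegDensity f)
    (hmean : Integrable fun z => z * f z)
    (hreg : StrictMonoOn (virtualValue f) (supp f)) (s : ℝ) :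
    ∫ v, max 0 (virtualValue f v - s) ∂dist f ≤
      (dist f).real {v : ℝ | virtualValueInv f s ≤ v} * ((virtualValueInv f s).toReal - s) := by
  have := hf.isProbabilityMeasure
  have key : ∀ᵐ v ∂dist f, max 0 (virtualValue f v - s) =
      {v : ℝ | virtualValueInv f s ≤ v}.indicator (fun v => virtualValue f v - s) v := by
    filter_upwards [hf.ae_lt_virtualValueInv_iff hreg s] with v hv
    by_cases h : virtualValue f v ≤ s
    · rw [max_eq_left (sub_nonpos.2 h), indicator_of_notMem]
      exact not_le.2 (hv.2 h)
    · rw [max_eq_right (sub_nonneg.2 (not_le.1 h).le), indicator_of_mem]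
      exact not_lt.1 fun h' => h (hv.1 h')
  have hne : virtualValueInv f s ≠ ⊥ := fun h => by
    have := hf.virtualValueInv_nonneg s; rw [h] at this; exact absurd this (by simp)
  rw [integral_congr_ae key]
  induction hp : virtualValueInv f s using EReal.rec with
  | bot => exact absurd hp hne
  | top => simp
  | coe p =>
    have hset : {v : ℝ | (p : EReal) ≤ v} = Ici p := by ext v; simp
    have hi := (hf.integrable_virtualValue hmean).integrableOn (s := Ici p)
    have hc : IntegrableOn (fun _ : ℝ => s) (Ici p) (dist f) := integrable_const s
    have := hf.integral_virtualValue_Ici_le hmean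
      (fun v hv _ => hf.Ioo_subset_supp hp hv)
    rw [hset, integral_indicator measurableSet_Ici, integral_sub hi hc, EReal.toReal_coe]
    simp only [integral_const, smul_eq_mul, measureReal_restrict_apply_univ]
    linarith

/-- An atomless random variable has a continuous distribution function. -/
lemma continuous_measureReal_le {α : Type*} [MeasurableSpace α] {μ : Measure α}
    [IsProbabilityMeasure μ] {X : α → ℝ} (hX : Measurable X) (h0 : ∀ s, μ {a | X a = s} = 0) :
    Continuous fun s => μ.real {a | X a ≤ s} := by
  have hp : IsProbabilityMeasure (μ.map X) := Measure.isProbabilityMeasure_map hX.aemeasurable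
  have he : (fun s => μ.real {a | X a ≤ s}) = ProbabilityTheory.cdf (μ.map X) := by
    ext s
    rw [ProbabilityTheory.cdf_eq_real, map_measureReal_apply hX measurableSet_Iic]
    rfl
  rw [he, continuous_iff_continuousAt]
  intro s
  set F := ProbabilityTheory.cdf (μ.map X) with hF
  rw [F.mono.continuousAt_iff_leftLim_eq_rightLim, F.rightLim_eq]
  have h1 := F.measure_singleton s
  rw [hF, ProbabilityTheory.measure_cdf, Measure.map_apply hX (measurableSet_singleton s)] at h1
  have h2 : μ (X ⁻¹' {s}) = 0 := h0 s
  rw [h2] at h1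
  have h3 := ENNReal.ofReal_eq_zero.1 h1.symm
  exact le_antisymm (F.mono.leftLim_le le_rfl) (by linarith)

end Inverse

/-! ### The reserve -/

section Reserve

variable {n : ℕ} {f : Fin n → ℝ → ℝ}

/-- The probability that no virtual value exceeds its cost by more than `t`. -/
noncomputable def noSaleProb (f : Fin n → ℝ → ℝ) (θ : Fin n → ℝ) (t : ℝ) : ℝ :=
  ∏ i, (dist (f i)).real {v | virtualValue (f i) v ≤ t + θ i}

lemma isProbabilityMeasure_jointDist (hf : ∀ i, IsNonnegDensity (f i)) :
    IsProbabilityMeasure (jointDist f) := by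
  have := fun i => (hf i).isProbabilityMeasure
  unfold jointDist
  infer_instance

lemma jointDist_real_pi (hf : ∀ i, IsNonnegDensity (f i)) (s : Fin n → Set ℝ) :
    (jointDist f).real (univ.pi s) = ∏ i, (dist (f i)).real (s i) := by
  have := fun i => (hf i).isProbabilityMeasure
  simp only [measureReal_def, jointDist, Measure.pi_pi, ENNReal.toReal_prod]

/-- For `t ≥ 0` the event is a box and independence gives the product. For `t < 0` it is empty,
since the supremum is nonnegative (also when `n = 0`), whence the constraint `0 ≤ t`. -/
lemma virtualReserve_eq (hf : ∀ i, IsNonnegDensity (f i)) (θ : Fin n → ℝ) :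
    virtualReserve f θ = sInf {t | 0 ≤ t ∧ 1 / 2 ≤ noSaleProb f θ t} := by
  unfold virtualReserve
  congr 1
  ext t
  simp only [mem_ofPred_eq]
  have h0 : ∀ v : Fin n → ℝ, 0 ≤ ⨆ i, max 0 (virtualValue (f i) (v i) - θ i) := fun v =>
    Real.iSup_nonneg fun i => le_max_left _ _
  rcases lt_or_ge t 0 with ht | ht
  · have : {v : Fin n → ℝ | (⨆ i, max 0 (virtualValue (f i) (v i) - θ i)) ≤ t} = ∅ := by
      ext v
      simp only [mem_ofPred_eq, mem_empty_iff_false, iff_false, not_le]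
      exact ht.trans_le (h0 v)
    rw [this]
    simp [not_le.2 ht]
  · have : {v : Fin n → ℝ | (⨆ i, max 0 (virtualValue (f i) (v i) - θ i)) ≤ t} =
        univ.pi fun i => {x | virtualValue (f i) x ≤ t + θ i} := by
      ext v
      simp only [mem_ofPred_eq, Set.mem_pi, mem_univ, forall_const]
      constructor
      · intro h i
        have := (le_ciSup (finite_range _).bddAbove i).trans h
        linarith [le_max_right 0 (virtualValue (f i) (v i) - θ i)]
      · exact fun h => Real.iSup_le (fun i => max_le ht (by linarith [h i])) ht
    rw [this, jointDist_real_pi hf, noSaleProb]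
    simp [ht]

lemma noSaleProb_mono (hf : ∀ i, IsNonnegDensity (f i)) {θ θ' : Fin n → ℝ} {t t' : ℝ}
    (h : ∀ i, t + θ i ≤ t' + θ' i) : noSaleProb f θ t ≤ noSaleProb f θ' t' := by
  have := fun i => (hf i).isProbabilityMeasure
  exact Finset.prod_le_prod (fun i _ => measureReal_nonneg)
    fun i _ => measureReal_mono fun v hv => le_trans hv (h i)

lemma continuous_measureReal_virtualValue_le {f : ℝ → ℝ} (hf : IsNonnegDensity f)
    (hreg : StrictMonoOn (virtualValue f) (supp f)) :
    Continuous fun s => (dist f).real {v | virtualValue f v ≤ s} := by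
  have := hf.isProbabilityMeasure
  exact continuous_measureReal_le hf.measurable_virtualValue (hf.measure_virtualValue_eq hreg)

lemma continuous_noSaleProb (hf : ∀ i, IsNonnegDensity (f i))
    (hreg : ∀ i, StrictMonoOn (virtualValue (f i)) (supp (f i))) (θ : Fin n → ℝ) :
    Continuous (noSaleProb f θ) :=
  continuous_finsetProd _ fun i _ =>
    (continuous_measureReal_virtualValue_le (hf i) (hreg i)).comp (continuous_add_const (θ i))

lemma tendsto_noSaleProb (hf : ∀ i, IsNonnegDensity (f i)) (θ : Fin n → ℝ) :
    Tendsto (noSaleProb f θ) atTop (𝓝 1) := by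
  have h : ∀ i, Tendsto (fun t => (dist (f i)).real {v | virtualValue (f i) v ≤ t + θ i})
      atTop (𝓝 1) := by
    intro i
    have := (hf i).isProbabilityMeasure
    have hX := (hf i).measurable_virtualValue
    have hp : IsProbabilityMeasure ((dist (f i)).map (virtualValue (f i))) :=
      Measure.isProbabilityMeasure_map hX.aemeasurable
    have h1 := (ProbabilityTheory.tendsto_cdf_atTop
      ((dist (f i)).map (virtualValue (f i)))).comp (tendsto_atTop_add_const_right _ (θ i) tendsto_id)
    refine h1.congr fun t => ?_
    rw [Function.comp, ProbabilityTheory.cdf_eq_real, map_measureReal_apply hX measurableSet_Iic]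
    rfl
  have := tendsto_finsetProd (Finset.univ : Finset (Fin n)) fun i _ => h i
  simp only [Finset.prod_const_one] at this
  exact this

lemma virtualReserve_le (hf : ∀ i, IsNonnegDensity (f i)) {θ : Fin n → ℝ} {t : ℝ} (ht : 0 ≤ t)
    (h : 1 / 2 ≤ noSaleProb f θ t) : virtualReserve f θ ≤ t := by
  rw [virtualReserve_eq hf]
  exact csInf_le ⟨0, fun _ h => h.1⟩ ⟨ht, h⟩

lemma virtualReserve_mem (hf : ∀ i, IsNonnegDensity (f i))
    (hreg : ∀ i, StrictMonoOn (virtualValue (f i)) (supp (f i))) (θ : Fin n → ℝ) :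
    0 ≤ virtualReserve f θ ∧ 1 / 2 ≤ noSaleProb f θ (virtualReserve f θ) := by
  rw [virtualReserve_eq hf]
  refine IsClosed.csInf_mem (s := {t | 0 ≤ t ∧ 1 / 2 ≤ noSaleProb f θ t}) ?_ ?_
    ⟨0, fun _ h => h.1⟩
  · exact isClosed_Ici.inter (isClosed_le continuous_const (continuous_noSaleProb hf hreg θ))
  · have h1 := (tendsto_noSaleProb hf θ).eventually (eventually_ge_nhds (b := 1 / 2) (by norm_num))
    obtain ⟨t, h1, h2⟩ := (h1.and (eventually_ge_atTop 0)).exists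
    exact ⟨t, h2, h1⟩

/-- A positive reserve is exceeded with probability one half. -/
lemma noSaleProb_virtualReserve_le (hf : ∀ i, IsNonnegDensity (f i))
    (hreg : ∀ i, StrictMonoOn (virtualValue (f i)) (supp (f i))) {θ : Fin n → ℝ}
    (h0 : 0 < virtualReserve f θ) : noSaleProb f θ (virtualReserve f θ) ≤ 1 / 2 := by
  by_contra! h
  have h1 := ((continuous_noSaleProb hf hreg θ).tendsto _).eventually (eventually_gt_nhds h)
  have h2 := (h1.filter_mono nhdsWithin_le_nhds).and (Ioo_mem_nhdsLT h0)
  obtain ⟨t, ht, ht'⟩ := h2.exists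
  exact ht'.2.not_ge (virtualReserve_le hf ht'.1.le ht.le)

lemma virtualReserve_anti (hf : ∀ i, IsNonnegDensity (f i))
    (hreg : ∀ i, StrictMonoOn (virtualValue (f i)) (supp (f i))) {θ θ' : Fin n → ℝ}
    (h : θ ≤ θ') : virtualReserve f θ' ≤ virtualReserve f θ := by
  obtain ⟨h0, h1⟩ := virtualReserve_mem hf hreg θ
  exact virtualReserve_le hf h0 (h1.trans (noSaleProb_mono hf fun i => by linarith [h i]))

/-- The reserve falls by no more than a single cost rises. -/
lemma virtualReserve_add_le (hf : ∀ i, IsNonnegDensity (f i))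
    (hreg : ∀ i, StrictMonoOn (virtualValue (f i)) (supp (f i))) {θ : Fin n → ℝ} {i : Fin n}
    {t : ℝ} (ht : θ i ≤ t) :
    virtualReserve f θ + θ i ≤ virtualReserve f (Function.update θ i t) + t := by
  obtain ⟨h0, h1⟩ := virtualReserve_mem hf hreg (Function.update θ i t)
  have h2 : virtualReserve f θ ≤ virtualReserve f (Function.update θ i t) + (t - θ i) := by
    refine virtualReserve_le hf (by linarith) (h1.trans (noSaleProb_mono hf fun j => ?_))
    by_cases hj : j = i
    · subst hj; rw [Function.update_self]; linarith
    · rw [Function.update_of_ne hj]; linarith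
  linarith

/-- The reserve is 1-Lipschitz in the sup norm: raising it by the distance of the costs compensates
any change of them. This serves the measurability of the mechanism's prices. -/
lemma continuous_virtualReserve (hf : ∀ i, IsNonnegDensity (f i))
    (hreg : ∀ i, StrictMonoOn (virtualValue (f i)) (supp (f i))) :
    Continuous (virtualReserve f) := by
  refine (LipschitzWith.of_le_add fun θ θ' => ?_).continuous
  obtain ⟨h0, h1⟩ := virtualReserve_mem hf hreg θ'
  refine virtualReserve_le hf (add_nonneg h0 dist_nonneg)
    (h1.trans (noSaleProb_mono hf fun i => ?_))
  have := (Real.dist_eq _ _ ▸ dist_le_pi_dist θ θ' i : |θ i - θ' i| ≤ _)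
  linarith [neg_abs_le (θ i - θ' i)]

end Reserve

/-! ### The buyer -/

section Buyer

variable {n : ℕ} {p p' : Fin n → EReal} {v : Fin n → ℝ} {i j : Fin n}

lemma coe_sub_nonneg_iff {x : ℝ} {q : EReal} : 0 ≤ (x : EReal) - q ↔ q ≤ x :=
  EReal.sub_nonneg (Or.inl (EReal.coe_ne_top x)) (Or.inl (EReal.coe_ne_bot x))

lemma Buys.price_le (h : Buys p v i) : p i ≤ v i := coe_sub_nonneg_iff.1 h.1

lemma Buys.price_ne_top (h : Buys p v i) : p i ≠ ⊤ := fun h' => by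
  have := h.price_le
  rw [h'] at this
  exact absurd this (by simp)

lemma Buys.unique (hi : Buys p v i) (hj : Buys p v j) : i = j := by
  rcases lt_trichotomy i j with h | h | h
  · exact absurd (hi.2.1 j) (hj.2.2 i h).not_ge
  · exact h
  · exact absurd (hj.2.1 i) (hi.2.2 j h).not_ge

lemma Buys.mono (hi : p i ≤ p' i) (hj : ∀ j ≠ i, p' j ≤ p j) (h : Buys p' v i) : Buys p v i := by
  have h1 : (v i : EReal) - p' i ≤ (v i : EReal) - p i := EReal.sub_le_sub le_rfl hi
  have h2 : ∀ j ≠ i, (v j : EReal) - p j ≤ (v j : EReal) - p' j := fun j hji =>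
    EReal.sub_le_sub le_rfl (hj j hji)
  refine ⟨h.1.trans h1, fun j => ?_, fun j hji => ?_⟩
  · by_cases hji : j = i
    · rw [hji]
    · exact (h2 j hji).trans ((h.2.1 j).trans h1)
  · exact ((h2 j hji.ne).trans_lt (h.2.2 j hji)).trans_le h1

lemma exists_buys (h : p i ≤ v i) : ∃ j, Buys p v j := by
  classical
  obtain ⟨k, -, hk⟩ := Finset.exists_max_image Finset.univ (fun j => (v j : EReal) - p j)
    ⟨i, Finset.mem_univ i⟩
  -- The least index among the maximizers respects the tie-breaking rule.
  set S := Finset.univ.filter fun m => ∀ j, (v j : EReal) - p j ≤ (v m : EReal) - p m with hS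
  have hne : S.Nonempty := ⟨k, by simpa [hS] using hk⟩
  have hm : ∀ j, (v j : EReal) - p j ≤ (v (S.min' hne) : EReal) - p (S.min' hne) := by
    simpa [hS] using S.min'_mem hne
  refine ⟨S.min' hne, (coe_sub_nonneg_iff.2 h).trans (hm i), hm, fun j hj => ?_⟩
  by_contra! hj'
  have : j ∈ S := by
    simp only [hS, Finset.mem_filter, Finset.mem_univ, true_and]
    exact fun l => (hm l).trans hj'
  exact hj.not_ge (S.min'_le j this)

lemma buys_of_forall_lt (h : p i ≤ v i) (hj : ∀ j ≠ i, (v j : EReal) < p j) : Buys p v i := by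
  obtain ⟨k, hk⟩ := exists_buys h
  by_cases hki : k = i
  · exact hki ▸ hk
  · exact absurd hk.price_le (hj k hki).not_ge

/-- Makes the section of the sale event in the buyer's own value for `i` an upper set, as Myerson's
bound requires. -/
lemma Buys.of_le_value {v : Fin n → ℝ} {a b : ℝ} (hab : a ≤ b)
    (h : Buys p (Function.update v i a) i) : Buys p (Function.update v i b) i := by
  have h1 : (a : EReal) - p i ≤ (b : EReal) - p i :=
    EReal.sub_le_sub (EReal.coe_le_coe_iff.2 hab) le_rfl
  obtain ⟨h2, h3, h4⟩ := h
  simp only [Function.update_self] at h2 h3 h4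
  refine ⟨?_, fun j => ?_, fun j hji => ?_⟩ <;> simp only [Function.update_self]
  · exact h2.trans h1
  · by_cases hji : j = i
    · subst hji; simp
    · have := h3 j
      rw [Function.update_of_ne hji] at this ⊢
      exact this.trans h1
  · have := h4 j hji
    rw [Function.update_of_ne hji.ne] at this ⊢
    exact this.trans_le h1

lemma measurableSet_buys (i : Fin n) :
    MeasurableSet {q : (Fin n → EReal) × (Fin n → ℝ) | Buys q.1 q.2 i} := by
  have h : ∀ j, Measurable fun q : (Fin n → EReal) × (Fin n → ℝ) => (q.2 j : EReal) - q.1 j :=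
    fun j => (measurable_coe_real_ereal.comp ((measurable_pi_apply j).comp measurable_snd)).sub
      ((measurable_pi_apply j).comp measurable_fst)
  have he : {q : (Fin n → EReal) × (Fin n → ℝ) | Buys q.1 q.2 i} =
      {q | 0 ≤ (q.2 i : EReal) - q.1 i} ∩
        ((⋂ j, {q | (q.2 j : EReal) - q.1 j ≤ (q.2 i : EReal) - q.1 i}) ∩
          ⋂ j, ⋂ (_ : j < i), {q | (q.2 j : EReal) - q.1 j < (q.2 i : EReal) - q.1 i}) := by
    ext q
    simp [Buys]
  rw [he]
  exact (measurableSet_le measurable_const (h i)).inter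
    ((MeasurableSet.iInter fun j => measurableSet_le (h j) (h i)).inter
      (MeasurableSet.iInter fun j => MeasurableSet.iInter fun _ => measurableSet_lt (h j) (h i)))

lemma measurableSet_buys_right (p : Fin n → EReal) (i : Fin n) :
    MeasurableSet {v | Buys p v i} :=
  measurable_prodMk_left (measurableSet_buys i)

end Buyer

/-! ### Resampling a coordinate -/

lemma measurable_update_prod {ι : Type*} [DecidableEq ι] (i : ι) :
    Measurable fun q : (ι → ℝ) × ℝ => Function.update q.1 i q.2 := by
  refine measurable_pi_iff.2 fun j => ?_
  by_cases hj : j = i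
  · subst hj; simpa using measurable_snd
  · simp only [Function.update_of_ne hj]
    exact (measurable_pi_apply j).comp measurable_fst

/-- Replacing a coordinate of a product distribution by an independent copy. -/
lemma measurePreserving_update {ι : Type*} [Fintype ι] [DecidableEq ι] (μ : ι → Measure ℝ)
    [∀ i, IsProbabilityMeasure (μ i)] (i : ι) :
    MeasurePreserving (fun q : (ι → ℝ) × ℝ => Function.update q.1 i q.2)
      ((Measure.pi μ).prod (μ i)) (Measure.pi μ) := by
  refine ⟨measurable_update_prod i, (Measure.pi_eq fun s hs => ?_).symm⟩
  rw [Measure.map_apply (measurable_update_prod i) (MeasurableSet.univ_pi hs)]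
  have he : (fun q : (ι → ℝ) × ℝ => Function.update q.1 i q.2) ⁻¹' (univ.pi s) =
      (univ.pi (Function.update s i univ)) ×ˢ s i := by
    ext q
    simp only [mem_preimage, Set.mem_pi, mem_univ, forall_const, mem_prod]
    constructor
    · refine fun h => ⟨fun j => ?_, by simpa using h i⟩
      by_cases hj : j = i
      · subst hj; simp
      · simpa [Function.update_of_ne hj] using h j
    · rintro ⟨h1, h2⟩ j
      by_cases hj : j = i
      · subst hj; simpa using h2
      · simpa [Function.update_of_ne hj] using h1 j
  rw [he, Measure.prod_prod, Measure.pi_pi, ← Finset.mul_prod_erase _ _ (Finset.mem_univ i),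
    ← Finset.mul_prod_erase _ (fun i => μ i (s i)) (Finset.mem_univ i), Function.update_self,
    measure_univ, one_mul, mul_comm]
  congr 1
  refine Finset.prod_congr rfl fun j hj => ?_
  rw [Function.update_of_ne (Finset.ne_of_mem_erase hj)]

/-! ### Pricing profit: upper bound, half-approximation, monotonicity -/

section Pricing

variable {n : ℕ} {f : Fin n → ℝ → ℝ}

lemma measurePreserving_update_jointDist (hf : ∀ i, IsNonnegDensity (f i)) (i : Fin n) :
    MeasurePreserving (fun q : (Fin n → ℝ) × ℝ => Function.update q.1 i q.2)
      ((jointDist f).prod (dist (f i))) (jointDist f) := by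
  have := fun i => (hf i).isProbabilityMeasure
  exact measurePreserving_update (fun i => dist (f i)) i

lemma integral_resample (hf : ∀ i, IsNonnegDensity (f i)) (i : Fin n) {F : (Fin n → ℝ) → ℝ}
    (hF : Integrable F (jointDist f)) :
    ∫ v, F v ∂jointDist f =
      ∫ v, (∫ u, F (Function.update v i u) ∂dist (f i)) ∂jointDist f := by
  have := fun i => (hf i).isProbabilityMeasure
  have := isProbabilityMeasure_jointDist hf
  have hmp := measurePreserving_update_jointDist hf i
  have h1 : ∫ v, F v ∂jointDist f =
      ∫ q : (Fin n → ℝ) × ℝ, F (Function.update q.1 i q.2) ∂(jointDist f).prod (dist (f i)) := by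
    conv_lhs => rw [← hmp.map_eq]
    exact integral_map hmp.measurable.aemeasurable (hmp.map_eq.symm ▸ hF.1)
  rw [h1]
  exact integral_prod _ (hmp.integrable_comp_of_integrable hF)

lemma lintegral_resample (hf : ∀ i, IsNonnegDensity (f i)) (i : Fin n)
    {F : (Fin n → ℝ) → ENNReal} (hF : Measurable F) :
    ∫⁻ v, F v ∂jointDist f =
      ∫⁻ v, (∫⁻ u, F (Function.update v i u) ∂dist (f i)) ∂jointDist f := by
  have := fun i => (hf i).isProbabilityMeasure
  have := isProbabilityMeasure_jointDist hf
  have hmp := measurePreserving_update_jointDist hf i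
  rw [← hmp.lintegral_comp hF]
  exact lintegral_prod _ (hF.comp hmp.measurable).aemeasurable

lemma measurePreserving_eval_jointDist (hf : ∀ i, IsNonnegDensity (f i)) (i : Fin n) :
    MeasurePreserving (fun v : Fin n → ℝ => v i) (jointDist f) (dist (f i)) := by
  have := fun i => (hf i).isProbabilityMeasure
  exact measurePreserving_eval (fun i => dist (f i)) i

lemma integral_eval_jointDist (hf : ∀ i, IsNonnegDensity (f i)) (i : Fin n) {h : ℝ → ℝ}
    (hh : Measurable h) : ∫ v, h (v i) ∂jointDist f = ∫ u, h u ∂dist (f i) := by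
  rw [← (measurePreserving_eval_jointDist hf i).map_eq,
    integral_map (measurable_pi_apply i).aemeasurable hh.aestronglyMeasurable]

lemma integrable_eval_jointDist (hf : ∀ i, IsNonnegDensity (f i)) (i : Fin n) {h : ℝ → ℝ}
    (hh : Integrable h (dist (f i))) : Integrable (fun v => h (v i)) (jointDist f) :=
  (measurePreserving_eval_jointDist hf i).integrable_comp_of_integrable hh

lemma saleProb_nonneg (p : Fin n → EReal) (i : Fin n) : 0 ≤ saleProb f p i := measureReal_nonneg

lemma saleProb_eq_zero_of_top {p : Fin n → EReal} {i : Fin n} (h : p i = ⊤) :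
    saleProb f p i = 0 := by
  have : {v | Buys p v i} = ∅ := by
    ext v
    simp only [mem_ofPred_eq, mem_empty_iff_false, iff_false]
    exact fun h' => h'.price_ne_top h
  rw [saleProb, this, measureReal_empty]

lemma sum_saleProb (hf : ∀ i, IsNonnegDensity (f i)) (p : Fin n → EReal) :
    ∑ i, saleProb f p i = (jointDist f).real (⋃ i, {v | Buys p v i}) := by
  have := isProbabilityMeasure_jointDist hf
  rw [measureReal_iUnion_fintype _ fun i => measurableSet_buys_right p i]
  · rfl
  · intro i j hij
    exact disjoint_left.2 fun v hi hj => hij (Buys.unique hi hj)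

lemma sum_saleProb_le_one (hf : ∀ i, IsNonnegDensity (f i)) (p : Fin n → EReal) :
    ∑ i, saleProb f p i ≤ 1 := by
  have := isProbabilityMeasure_jointDist hf
  rw [sum_saleProb hf]
  exact measureReal_le_one

lemma saleProb_anti (hf : ∀ i, IsNonnegDensity (f i)) {p p' : Fin n → EReal} {i : Fin n}
    (hi : p i ≤ p' i) (hj : ∀ j ≠ i, p' j ≤ p j) : saleProb f p' i ≤ saleProb f p i := by
  have := isProbabilityMeasure_jointDist hf
  exact measureReal_mono fun v hv => Buys.mono hi hj hv

/-- The revenue of an item is at most the expected virtual value of its buyers. -/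
lemma integral_virtualValue_sub_price_nonneg (hf : ∀ i, IsNonnegDensity (f i))
    (hmean : ∀ i, Integrable fun z => z * f i z) {p : Fin n → EReal} {i : Fin n} {a : ℝ}
    (hp : p i = a) :
    0 ≤ ∫ v in {v | Buys p v i}, (virtualValue (f i) (v i) - a) ∂jointDist f := by
  have := fun i => (hf i).isProbabilityMeasure
  have := isProbabilityMeasure_jointDist hf
  have hB := measurableSet_buys_right p i
  have hint : Integrable ({v | Buys p v i}.indicator fun v => virtualValue (f i) (v i) - a)
      (jointDist f) :=
    ((integrable_eval_jointDist hf i ((hf i).integrable_virtualValue (hmean i))).sub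
      (integrable_const a)).indicator hB
  rw [← integral_indicator hB, integral_resample hf i hint]
  refine integral_nonneg fun v => ?_
  set S : Set ℝ := {u | Buys p (Function.update v i u) i} with hSdef
  have hS : MeasurableSet S :=
    (measurable_update_prod i).comp measurable_prodMk_left hB
  have he : ∀ u, ({v | Buys p v i}.indicator (fun v => virtualValue (f i) (v i) - a))
      (Function.update v i u) = S.indicator (fun u => virtualValue (f i) u - a) u := by
    intro u
    by_cases hu : u ∈ S
    · rw [indicator_of_mem hu, indicator_of_mem (by exact hu)]
      simp
    · rw [indicator_of_notMem hu, indicator_of_notMem (by exact hu)]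
  simp only [Pi.zero_apply, he]
  have hc : IntegrableOn (fun _ : ℝ => a) S (dist (f i)) := integrable_const a
  have := (hf i).price_mul_le (hmean i) hS (fun x y hxy hx => Buys.of_le_value hxy hx)
    (p := a) (fun u hu => by
      have := Buys.price_le hu
      rw [hp, Function.update_self] at this
      exact EReal.coe_le_coe_iff.1 this)
  rw [integral_indicator hS,
    integral_sub ((hf i).integrable_virtualValue (hmean i)).integrableOn hc]
  simp only [integral_const, smul_eq_mul, measureReal_restrict_apply_univ]
  linarith

/-- A bound on the profit of every price vector, for every reserve `r`. -/
lemma pricingProfit_le (hf : ∀ i, IsNonnegDensity (f i))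
    (hmean : ∀ i, Integrable fun z => z * f i z) (θ : Fin n → ℝ) {p : Fin n → EReal}
    (hp : ∀ i, p i ≠ ⊥) {r : ℝ} (hr : 0 ≤ r) :
    pricingProfit f θ p ≤
      r + ∑ i, ∫ u, max 0 (virtualValue (f i) u - (r + θ i)) ∂dist (f i) := by
  have := fun i => (hf i).isProbabilityMeasure
  have := isProbabilityMeasure_jointDist hf
  -- On the event of sale, the margin beyond `r` is replaced by the virtual excess and then by its
  -- positive part over the whole space.
  have key : ∀ i, saleProb f p i * ((p i).toReal - θ i) ≤
      r * saleProb f p i + ∫ u, max 0 (virtualValue (f i) u - (r + θ i)) ∂dist (f i) := by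
    intro i
    have hm := (hf i).measurable_virtualValue
    have h0 : 0 ≤ ∫ u, max 0 (virtualValue (f i) u - (r + θ i)) ∂dist (f i) :=
      integral_nonneg fun u => le_max_left _ _
    induction hpi : p i using EReal.rec with
    | bot => exact absurd hpi (hp i)
    | top => rw [saleProb_eq_zero_of_top hpi]; simpa using h0
    | coe a =>
      have h1 := integral_virtualValue_sub_price_nonneg hf hmean hpi
      set B := {v | Buys p v i} with hBdef
      have hB : MeasurableSet B := measurableSet_buys_right p i
      have hiv := integrable_eval_jointDist hf i ((hf i).integrable_virtualValue (hmean i))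
      have hie : Integrable (fun v : Fin n → ℝ => max 0 (virtualValue (f i) (v i) - (r + θ i)))
          (jointDist f) := by
        simpa [max_comm] using (hiv.sub (integrable_const (r + θ i))).pos_part
      have hc : ∀ b : ℝ, IntegrableOn (fun _ => b) B (jointDist f) := fun b => integrable_const b
      have h2 : ∫ v in B, (virtualValue (f i) (v i) - (r + θ i)) ∂jointDist f ≤
          ∫ u, max 0 (virtualValue (f i) u - (r + θ i)) ∂dist (f i) := by
        rw [← integral_eval_jointDist hf i (measurable_const.max (hm.sub_const _))]
        refine le_trans (integral_mono (hiv.sub (integrable_const _)).integrableOn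
          hie.integrableOn fun v => le_max_right _ _) ?_
        exact setIntegral_le_integral hie (ae_of_all _ fun v => le_max_left _ _)
      rw [integral_sub hiv.integrableOn (hc _)] at h1 h2
      simp only [integral_const, smul_eq_mul, measureReal_restrict_apply_univ] at h1 h2
      have h3 : saleProb f p i = (jointDist f).real B := rfl
      rw [h3, EReal.toReal_coe]
      linarith
  refine (Finset.sum_le_sum fun i _ => key i).trans ?_
  rw [Finset.sum_add_distrib, ← Finset.mul_sum]
  have := mul_le_mul_of_nonneg_left (sum_saleProb_le_one hf p) hr
  linarith

lemma noSaleProb_eq (hf : ∀ i, IsNonnegDensity (f i))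
    (hreg : ∀ i, StrictMonoOn (virtualValue (f i)) (supp (f i))) (θ : Fin n → ℝ) :
    noSaleProb f θ (virtualReserve f θ) =
      ∏ i, (dist (f i)).real {v : ℝ | (v : EReal) < reservePrices f θ i} :=
  Finset.prod_congr rfl fun i _ => ((hf i).measureReal_lt_virtualValueInv (hreg i) _).symm

lemma reservePrices_ne_bot (hf : ∀ i, IsNonnegDensity (f i)) (θ : Fin n → ℝ) (i : Fin n) :
    reservePrices f θ i ≠ ⊥ := fun h => by
  have := (hf i).virtualValueInv_nonneg (virtualReserve f θ + θ i)
  rw [reservePrices] at h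
  rw [h] at this
  exact absurd this (by simp)

/-- Item `i` is sold at least half as often as it would be on its own. -/
lemma half_mul_le_saleProb (hf : ∀ i, IsNonnegDensity (f i))
    (hreg : ∀ i, StrictMonoOn (virtualValue (f i)) (supp (f i))) (θ : Fin n → ℝ) (i : Fin n) :
    1 / 2 * (dist (f i)).real {v : ℝ | reservePrices f θ i ≤ v} ≤
      saleProb f (reservePrices f θ) i := by
  have := fun i => (hf i).isProbabilityMeasure
  have := isProbabilityMeasure_jointDist hf
  set p := reservePrices f θ with hp
  have h1 := (virtualReserve_mem hf hreg θ).2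
  rw [noSaleProb_eq hf hreg, ← hp] at h1
  -- The box where `v_i` reaches its price and every other value stays below its own.
  have h2 : univ.pi (Function.update (fun j => {v : ℝ | (v : EReal) < p j}) i
      {v : ℝ | p i ≤ v}) ⊆ {v | Buys p v i} := by
    intro v hv
    rw [Set.mem_pi] at hv
    refine buys_of_forall_lt (by simpa using hv i (mem_univ i)) fun j hj => ?_
    simpa [Function.update_of_ne hj] using hv j (mem_univ j)
  refine le_trans ?_ (measureReal_mono h2)
  rw [jointDist_real_pi hf, ← Finset.mul_prod_erase _ _ (Finset.mem_univ i),
    Function.update_self, mul_comm]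
  refine mul_le_mul_of_nonneg_left ?_ measureReal_nonneg
  rw [← Finset.mul_prod_erase _ _ (Finset.mem_univ i)] at h1
  have h3 : ∏ j ∈ Finset.univ.erase i, (dist (f j)).real
      (Function.update (fun j => {v : ℝ | (v : EReal) < p j}) i {v : ℝ | p i ≤ v} j) =
      ∏ j ∈ Finset.univ.erase i, (dist (f j)).real {v : ℝ | (v : EReal) < p j} :=
    Finset.prod_congr rfl fun j hj => by rw [Function.update_of_ne (Finset.ne_of_mem_erase hj)]
  rw [h3]
  -- Omitting the factor of `i` can only increase the product, which was at least 1/2.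
  exact h1.trans (mul_le_of_le_one_left (Finset.prod_nonneg fun _ _ => measureReal_nonneg)
    measureReal_le_one)

/-- Something is sold as soon as one value reaches its price, and a positive reserve is exceeded
with probability at least 1/2. -/
lemma half_le_sum_saleProb (hf : ∀ i, IsNonnegDensity (f i))
    (hreg : ∀ i, StrictMonoOn (virtualValue (f i)) (supp (f i))) {θ : Fin n → ℝ}
    (h0 : 0 < virtualReserve f θ) : 1 / 2 ≤ ∑ i, saleProb f (reservePrices f θ) i := by
  have := isProbabilityMeasure_jointDist hf
  have h1 := noSaleProb_virtualReserve_le hf hreg h0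
  rw [noSaleProb_eq hf hreg, ← jointDist_real_pi hf] at h1
  have hm : MeasurableSet (univ.pi fun i => {v : ℝ | (v : EReal) < reservePrices f θ i}) :=
    MeasurableSet.univ_pi fun i => measurableSet_lt measurable_coe_real_ereal measurable_const
  have h2 := probReal_compl_eq_one_sub (μ := jointDist f) hm
  rw [sum_saleProb hf]
  refine le_trans (by linarith) (measureReal_mono (μ := jointDist f) (s₁ := (univ.pi fun i =>
    {v : ℝ | (v : EReal) < reservePrices f θ i})ᶜ) fun v hv => ?_)
  simp only [mem_compl_iff, Set.mem_pi, mem_univ, forall_const, mem_ofPred_eq, not_forall,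
    not_lt] at hv
  obtain ⟨i, hi⟩ := hv
  exact mem_iUnion.2 (exists_buys hi)

/-- The left side is half of the bound in `pricingProfit_le` at the median. -/
lemma le_pricingProfit_reservePrices (hf : ∀ i, IsNonnegDensity (f i))
    (hmean : ∀ i, Integrable fun z => z * f i z)
    (hreg : ∀ i, StrictMonoOn (virtualValue (f i)) (supp (f i))) (θ : Fin n → ℝ) :
    1 / 2 * (virtualReserve f θ + ∑ i, ∫ u,
      max 0 (virtualValue (f i) u - (virtualReserve f θ + θ i)) ∂dist (f i)) ≤
      pricingProfit f θ (reservePrices f θ) := by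
  set r := virtualReserve f θ with hr
  have hr0 : 0 ≤ r := (virtualReserve_mem hf hreg θ).1
  have key : ∀ i, r * saleProb f (reservePrices f θ) i +
      1 / 2 * ∫ u, max 0 (virtualValue (f i) u - (r + θ i)) ∂dist (f i) ≤
      saleProb f (reservePrices f θ) i * ((reservePrices f θ i).toReal - θ i) := by
    intro i
    have h1 := (hf i).integral_excess_le (hmean i) (hreg i) (r + θ i)
    have h2 := half_mul_le_saleProb hf hreg θ i
    have h3 := (hf i).le_virtualValueInv_self (r + θ i)
    have he : virtualValueInv (f i) (r + θ i) = reservePrices f θ i := rfl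
    rw [he] at h1 h3
    have hbot := reservePrices_ne_bot hf θ i
    induction hpi : reservePrices f θ i using EReal.rec with
    | bot => exact absurd hpi hbot
    -- An item that is not offered loses nothing: `h1` then says that its expected virtual excess is
    -- at most zero.
    | top =>
      rw [saleProb_eq_zero_of_top hpi]
      rw [hpi] at h1
      simp only [top_le_iff, EReal.coe_ne_top, ofPred_false, measureReal_empty, zero_mul] at h1
      linarith
    | coe a =>
      rw [hpi] at h1 h2 h3
      rw [EReal.toReal_coe] at *
      have h3 := EReal.coe_le_coe_iff.1 h3
      have := mul_le_mul_of_nonneg_right h2 (sub_nonneg.2 h3)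
      linarith
  refine le_trans ?_ (Finset.sum_le_sum fun i _ => key i)
  rw [Finset.sum_add_distrib, ← Finset.mul_sum, ← Finset.mul_sum, mul_add]
  -- At `r = 0` a sale may be less likely than 1/2, but the term it multiplies vanishes.
  rcases hr0.eq_or_lt with h | h
  · simp [← h]
  · have := mul_le_mul_of_nonneg_left (half_le_sum_saleProb hf hreg (hr ▸ h)) hr0
    linarith

/-- The anonymous virtual reserve prices earn at least half of the optimal profit. -/
theorem half_mul_pricingProfit_le (hf : ∀ i, IsNonnegDensity (f i))
    (hmean : ∀ i, Integrable fun z => z * f i z)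
    (hreg : ∀ i, StrictMonoOn (virtualValue (f i)) (supp (f i))) (θ : Fin n → ℝ)
    (p : Fin n → EReal) (hp : ∀ i, p i ≠ ⊥) :
    1 / 2 * pricingProfit f θ p ≤ pricingProfit f θ (reservePrices f θ) := by
  refine le_trans ?_ (le_pricingProfit_reservePrices hf hmean hreg θ)
  have := pricingProfit_le hf hmean θ hp (virtualReserve_mem hf hreg θ).1
  linarith

/-- Raising the cost of an item raises its price and lowers the other prices. -/
theorem saleProb_update_le (hf : ∀ i, IsNonnegDensity (f i))
    (hreg : ∀ i, StrictMonoOn (virtualValue (f i)) (supp (f i))) (θ : Fin n → ℝ) (i : Fin n)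
    (t : ℝ) (ht : θ i ≤ t) :
    saleProb f (reservePrices f (Function.update θ i t)) i ≤
      saleProb f (reservePrices f θ) i := by
  refine saleProb_anti hf (monotone_virtualValueInv ?_) fun j hj => monotone_virtualValueInv ?_
  · rw [Function.update_self]
    exact virtualReserve_add_le hf hreg ht
  · rw [Function.update_of_ne hj]
    gcongr
    exact virtualReserve_anti hf hreg (le_update_iff.2 ⟨ht, fun _ _ => le_rfl⟩)

end Pricing

/-! ### Incentives of a seller -/

section Seller

variable {S : Set ℝ} {U y : ℝ → ℝ}

lemma antitoneOn_of_dominant (h : ∀ a ∈ S, ∀ b ∈ S, U b + y b * (b - a) ≤ U a) :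
    AntitoneOn y S := by
  intro a ha b hb hab
  rcases hab.eq_or_lt with rfl | hab
  · exact le_rfl
  · have h1 := h a ha b hb
    have h2 := h b hb a ha
    by_contra! h3
    nlinarith [mul_pos (sub_pos.2 h3) (sub_pos.2 hab)]

/-- Each incentive constraint bounds the drop of `U` below by a one-step lower sum of the
non-increasing `y`. Bisecting the interval `k` times leaves the error `(y a - y b) (b - a) / 2 ^ k`,
because the drops of `y` telescope over the two halves. -/
lemma intervalIntegral_le_of_dominant (hS : S.OrdConnected)
    (h : ∀ a ∈ S, ∀ b ∈ S, U b + y b * (b - a) ≤ U a) {a b : ℝ} (ha : a ∈ S) (hb : b ∈ S)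
    (hab : a ≤ b) : ∫ u in a..b, y u ≤ U a - U b := by
  have hanti := antitoneOn_of_dominant h
  have hint : ∀ s ∈ S, ∀ t ∈ S, s ≤ t → IntervalIntegrable y volume s t := fun s hs t ht hst =>
    (hanti.mono (by rw [uIcc_of_le hst]; exact hS.out hs ht)).intervalIntegrable
  have key : ∀ k : ℕ, ∀ s ∈ S, ∀ t ∈ S, s ≤ t →
      ∫ u in s..t, y u ≤ U s - U t + (y s - y t) * (t - s) / 2 ^ k := by
    intro k
    induction k with
    | zero =>
      intro s hs t ht hst
      have h1 : ∫ u in s..t, y u ≤ ∫ _ in s..t, y s :=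
        intervalIntegral.integral_mono_on hst (hint s hs t ht hst) intervalIntegrable_const
          fun u hu => hanti hs (hS.out hs ht hu) hu.1
      rw [intervalIntegral.integral_const, smul_eq_mul] at h1
      have := h s hs t ht
      simp only [pow_zero, div_one]
      linarith
    | succ k ih =>
      intro s hs t ht hst
      have h1 : s ≤ (s + t) / 2 := by linarith
      have h2 : (s + t) / 2 ≤ t := by linarith
      have hm : (s + t) / 2 ∈ S := hS.out hs ht ⟨h1, h2⟩
      have h3 := ih s hs _ hm h1
      have h4 := ih _ hm t ht h2
      rw [← intervalIntegral.integral_add_adjacent_intervals (hint s hs _ hm h1)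
        (hint _ hm t ht h2)]
      refine (add_le_add h3 h4).trans (le_of_eq ?_)
      field_simp
      ring
  have hlim : Tendsto (fun k : ℕ => U a - U b + (y a - y b) * (b - a) / 2 ^ k) atTop
      (𝓝 (U a - U b + 0)) :=
    tendsto_const_nhds.add (tendsto_const_nhds.div_atTop
      (tendsto_pow_atTop_atTop_of_one_lt (by norm_num)))
  rw [add_zero] at hlim
  exact ge_of_tendsto' hlim fun k => key k a ha b hb hab

/-- The utility of a seller with a dominant-strategy truthful report is at least the information
rent. -/
lemma lintegral_le_of_dominant (hS : S.OrdConnected) (hU : ∀ a ∈ S, 0 ≤ U a) (hy : ∀ u, 0 ≤ y u)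
    (h : ∀ a ∈ S, ∀ b ∈ S, U b + y b * (b - a) ≤ U a) {a : ℝ} (ha : a ∈ S) :
    ∫⁻ u in S ∩ Ioi a, ENNReal.ofReal (y u) ≤ ENNReal.ofReal (U a) := by
  have hanti := antitoneOn_of_dominant h
  have h1 : ∀ b ∈ S, ∫⁻ u in Ioc a b, ENNReal.ofReal (y u) ≤ ENNReal.ofReal (U a) := by
    intro b hb
    rcases lt_or_ge b a with hba | hab
    · rw [Ioc_eq_empty (by simpa using hba.le)]; simp
    have hi : IntervalIntegrable y volume a b :=
      (hanti.mono (by rw [uIcc_of_le hab]; exact hS.out ha hb)).intervalIntegrable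
    rw [← ofReal_integral_eq_lintegral_ofReal
      ((intervalIntegrable_iff_integrableOn_Ioc_of_le hab).1 hi) (ae_of_all _ hy),
      ← intervalIntegral.integral_of_le hab]
    refine ENNReal.ofReal_le_ofReal ?_
    have := intervalIntegral_le_of_dominant hS h ha hb hab
    linarith [hU b hb]
  -- `M` holds at most the greatest element of `S`. Away from this null set, `S ∩ Ioi a` is covered
  -- by the directed countable family `Ioc a q` with rational `q ∈ S`, and monotone convergence
  -- applies.
  set M : Set ℝ := {u | u ∈ S ∩ Ioi a ∧ ∀ w ∈ S, w ≤ u} with hM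
  have hM0 : volume M = 0 := Set.Subsingleton.measure_zero
    (fun u hu w hw => le_antisymm (hw.2 u hu.1.1) (hu.2 w hw.1.1)) _
  have h2 : (S ∩ Ioi a : Set ℝ) ≤ᵐ[volume]
      (⋃ q : {q : ℚ // (q : ℝ) ∈ S}, Ioc a (q : ℝ) : Set ℝ) := by
    have : ∀ᵐ u, u ∉ M := by simpa [ae_iff] using hM0
    filter_upwards [this] with u hu huS
    have huS : u ∈ S ∩ Ioi a := huS
    have : ∃ w ∈ S, u < w := by
      by_contra! hc
      exact hu ⟨huS, hc⟩
    obtain ⟨w, hw, huw⟩ := this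
    obtain ⟨q, hq1, hq2⟩ := exists_rat_btwn huw
    exact mem_iUnion.2 ⟨⟨q, hS.out huS.1 hw ⟨hq1.le, hq2.le⟩⟩, huS.2, hq1.le⟩
  refine (lintegral_mono' (Measure.restrict_mono_ae h2) le_rfl).trans ?_
  rw [setLIntegral_iUnion_of_directed]
  · exact iSup_le fun q => h1 _ q.2
  · intro q q'
    rcases le_total (q : ℚ) q' with hqq | hqq
    · exact ⟨q', Ioc_subset_Ioc_right (by exact_mod_cast hqq), subset_rfl⟩
    · exact ⟨q, subset_rfl, Ioc_subset_Ioc_right (by exact_mod_cast hqq)⟩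

/-- A non-increasing probability of sale, with the information rent as utility, makes the truthful
report dominant. -/
lemma rent_add_le (hS : S.OrdConnected) (hy : AntitoneOn y S)
    (hint : IntegrableOn y S) {a b : ℝ} (ha : a ∈ S) (hb : b ∈ S) :
    y b * (b - a) + ∫ u in S ∩ Ioi b, y u ≤ ∫ u in S ∩ Ioi a, y u := by
  have hsplit : ∀ s ∈ S, ∀ t ∈ S, s ≤ t →
      ∫ u in S ∩ Ioi s, y u = (∫ u in Ioc s t, y u) + ∫ u in S ∩ Ioi t, y u := by
    intro s hs t ht hst
    have hsub : Ioc s t ⊆ S := Ioc_subset_Icc_self.trans (hS.out hs ht)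
    have he : S ∩ Ioi s = Ioc s t ∪ S ∩ Ioi t := by
      ext u
      simp only [mem_inter_iff, mem_Ioi, mem_union, mem_Ioc]
      constructor
      · rintro ⟨h1, h2⟩
        rcases le_or_gt u t with h | h
        · exact Or.inl ⟨h2, h⟩
        · exact Or.inr ⟨h1, h⟩
      · rintro (h | h)
        · exact ⟨hsub h, h.1⟩
        · exact ⟨h.1, hst.trans_lt h.2⟩
    have hd : Disjoint (Ioc s t) (S ∩ Ioi t) :=
      disjoint_left.2 fun u h1 h2 => (not_lt.2 h1.2) h2.2
    rw [he, setIntegral_union hd (hS.measurableSet.inter measurableSet_Ioi)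
      (hint.mono_set hsub) (hint.mono_set inter_subset_left)]
  have hconst : ∀ s t r : ℝ, s ≤ t → ∫ _ in Ioc s t, r = r * (t - s) := by
    intro s t r hst
    simp [hst, mul_comm]
  have hic : ∀ s t r : ℝ, IntegrableOn (fun _ : ℝ => r) (Ioc s t) := fun s t r => by simp
  rcases le_total a b with hab | hab
  · have hsub : Ioc a b ⊆ S := Ioc_subset_Icc_self.trans (hS.out ha hb)
    rw [hsplit a ha b hb hab, ← hconst a b _ hab]
    refine add_le_add_left ?_ _
    exact setIntegral_mono_on (hic _ _ _) (hint.mono_set hsub) measurableSet_Ioc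
      fun u hu => hy (hsub hu) hb hu.2
  · have hsub : Ioc b a ⊆ S := Ioc_subset_Icc_self.trans (hS.out hb ha)
    rw [hsplit b hb a ha hab]
    have : ∫ u in Ioc b a, y u ≤ ∫ _ in Ioc b a, y b :=
      setIntegral_mono_on (hint.mono_set hsub) (hic _ _ _) measurableSet_Ioc
        fun u hu => hy hb (hsub hu) hu.1.le
    rw [hconst b a _ hab] at this
    linarith

end Seller

/-! ### Virtual costs -/

section Cost

lemma IsNonnegDensity.cdf_comp_neg {g : ℝ → ℝ} (hg : IsNonnegDensity g) (z : ℝ) :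
    cdf (fun t => g (-t)) z = 1 - cdf g (-z) := by
  have h1 : cdf (fun t => g (-t)) z = ∫ t in Ioi (-z), g t := integral_comp_neg_Iic z g
  have h2 := intervalIntegral.integral_Iic_add_Ioi (b := -z) hg.integrable.integrableOn
    hg.integrable.integrableOn
  rw [hg.integral_eq_one] at h2
  rw [h1, cdf]
  linarith

/-- The hazard rate of `-c` at `-z` is `g z / G z`, the reciprocal of the added term. Where `G`
vanishes it is undefined, but there the added term is zero. -/
lemma IsNonnegDensity.monotoneOn_virtualCost {g : ℝ → ℝ} (hg : IsNonnegDensity g)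
    (h : HasMHR fun z => g (-z)) : MonotoneOn (virtualCost g) (supp g) := by
  intro a ha b hb hab
  have ha' : 0 < g a := ha
  have hb' : 0 < g b := hb
  refine add_le_add hab ?_
  rcases (hg.cdf_nonneg a).eq_or_lt with h0 | h0
  · rw [← h0, zero_div]
    exact div_nonneg (hg.cdf_nonneg b) hb'.le
  · have h0b : 0 < cdf g b := h0.trans_le (hg.monotone_cdf hab)
    have h1 := h (a := -b) (b := -a)
      (by simp only [mem_ofPred_eq, hg.cdf_comp_neg, neg_neg]; linarith)
      (by simp only [mem_ofPred_eq, hg.cdf_comp_neg, neg_neg]; linarith) (neg_le_neg hab)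
    simp only [hazardRate, hg.cdf_comp_neg, neg_neg, sub_sub_cancel] at h1
    rw [div_le_div_iff₀ h0b h0] at h1
    rw [div_le_div_iff₀ ha' hb']
    linarith

variable {n : ℕ} {g : Fin n → ℝ → ℝ} {x : (Fin n → ℝ) → ℝ}

lemma measurable_rent (hg : ∀ i, IsNonnegDensity (g i)) (hx : Measurable x) (i : Fin n) :
    Measurable fun c : Fin n → ℝ =>
      ∫⁻ u in supp (g i) ∩ Ioi (c i), ENNReal.ofReal (x (Function.update c i u)) := by
  have hR : MeasurableSet {q : (Fin n → ℝ) × ℝ | q.2 ∈ supp (g i) ∩ Ioi (q.1 i)} :=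
    ((hg i).measurableSet_supp.preimage measurable_snd).inter
      (measurableSet_lt ((measurable_pi_apply i).comp measurable_fst) measurable_snd)
  have he : ∀ c : Fin n → ℝ,
      ∫⁻ u in supp (g i) ∩ Ioi (c i), ENNReal.ofReal (x (Function.update c i u)) =
      ∫⁻ u, {q : (Fin n → ℝ) × ℝ | q.2 ∈ supp (g i) ∩ Ioi (q.1 i)}.indicator
        (fun q => ENNReal.ofReal (x (Function.update q.1 i q.2))) (c, u) := fun c => by
    rw [← lintegral_indicator ((hg i).measurableSet_supp.inter measurableSet_Ioi)]
    rfl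
  simp only [he]
  exact Measurable.lintegral_prod_right'
    ((hx.comp (measurable_update_prod i)).ennreal_ofReal.indicator hR)

/-- The expected information rent is the expected excess of the virtual cost over the cost. -/
lemma lintegral_rent (hg : ∀ i, IsNonnegDensity (g i)) (hx : Measurable x) (i : Fin n) :
    ∫⁻ c, (∫⁻ u in supp (g i) ∩ Ioi (c i), ENNReal.ofReal (x (Function.update c i u)))
        ∂jointDist g =
      ∫⁻ c, ENNReal.ofReal (cdf (g i) (c i) / g i (c i)) * ENNReal.ofReal (x c) ∂jointDist g := by
  have hm : Measurable fun c : Fin n → ℝ =>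
      ENNReal.ofReal (cdf (g i) (c i) / g i (c i)) * ENNReal.ofReal (x c) :=
    (((hg i).monotone_cdf.measurable.div (hg i).measurable).comp
      (measurable_pi_apply i)).ennreal_ofReal.mul hx.ennreal_ofReal
  -- Resampling `c_i` reduces the claim to one-dimensional Fubini with the other costs fixed.
  rw [lintegral_resample hg i (measurable_rent hg hx i), lintegral_resample hg i hm]
  refine lintegral_congr fun c => ?_
  simp only [Function.update_self, Function.update_idem]
  exact ((hg i).lintegral_cdf_ratio
    (hx.comp ((measurable_update_prod i).comp measurable_prodMk_left)).ennreal_ofReal).symm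

lemma ae_forall_mem_supp (hg : ∀ i, IsNonnegDensity (g i)) :
    ∀ᵐ c ∂jointDist g, ∀ i, c i ∈ supp (g i) :=
  ae_all_iff.2 fun i =>
    (measurePreserving_eval_jointDist hg i).quasiMeasurePreserving.ae (hg i).ae_mem_supp

/-- Costs and information rents add up to virtual costs. -/
lemma lintegral_cost_add_rent (hg : ∀ i, IsNonnegDensity (g i)) (hx : Measurable x)
    (hx0 : ∀ c, 0 ≤ x c) (i : Fin n) :
    ∫⁻ c, (ENNReal.ofReal (x c * c i) +
        ∫⁻ u in supp (g i) ∩ Ioi (c i), ENNReal.ofReal (x (Function.update c i u)))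
        ∂jointDist g =
      ∫⁻ c, ENNReal.ofReal (x c * virtualCost (g i) (c i)) ∂jointDist g := by
  rw [lintegral_add_right _ (measurable_rent hg hx i), lintegral_rent hg hx i,
    ← lintegral_add_left (show Measurable fun c : Fin n → ℝ => ENNReal.ofReal (x c * c i) from
      (hx.mul (measurable_pi_apply i)).ennreal_ofReal)]
  refine lintegral_congr_ae ((ae_forall_mem_supp hg).mono fun c hc => ?_)
  have h1 : 0 ≤ cdf (g i) (c i) / g i (c i) :=
    div_nonneg ((hg i).cdf_nonneg _) ((hg i).nonneg _)
  have h2 : 0 ≤ c i := (hg i).nonneg_of_mem_supp (hc i)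
  simp only [virtualCost, mul_add]
  rw [ENNReal.ofReal_add (mul_nonneg (hx0 c) h2) (mul_nonneg (hx0 c) h1), mul_comm (x c) (_ / _),
    ENNReal.ofReal_mul h1]

end Cost

/-! ### Protocols -/

section Protocols

variable {n : ℕ} {f g : Fin n → ℝ → ℝ} {M : Protocol n}

lemma measurable_saleProb (hf : ∀ i, IsNonnegDensity (f i)) (i : Fin n) :
    Measurable fun p : Fin n → EReal => saleProb f p i := by
  have := isProbabilityMeasure_jointDist hf
  exact (measurable_measure_prodMk_left (measurableSet_buys i)).ennreal_toReal

lemma Protocol.measurable_alloc (hf : ∀ i, IsNonnegDensity (f i))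
    (hM : Measurable fun q : unitInterval × (Fin n → ℝ) => M.price q.1 q.2) (i : Fin n) :
    Measurable fun c => M.alloc f c i := by
  have := isProbabilityMeasure_jointDist hf
  have hs : MeasurableSet {q : (Fin n → ℝ) × unitInterval × (Fin n → ℝ) |
      Buys (M.price q.2.1 q.1) q.2.2 i} :=
    ((hM.comp ((measurable_fst.comp measurable_snd).prodMk measurable_fst)).prodMk
      (measurable_snd.comp measurable_snd)) (measurableSet_buys i)
  exact (measurable_measure_prodMk_left hs).ennreal_toReal

lemma Protocol.alloc_eq_integral (hf : ∀ i, IsNonnegDensity (f i))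
    (hM : Measurable fun q : unitInterval × (Fin n → ℝ) => M.price q.1 q.2) (c : Fin n → ℝ)
    (i : Fin n) : M.alloc f c i = ∫ ω, saleProb f (M.price ω c) i := by
  have := isProbabilityMeasure_jointDist hf
  have hp : Measurable fun ω => M.price ω c := hM.comp measurable_prodMk_right
  have hs : MeasurableSet {q : unitInterval × (Fin n → ℝ) | Buys (M.price q.1 c) q.2 i} :=
    ((hp.comp measurable_fst).prodMk measurable_snd) (measurableSet_buys i)
  rw [Protocol.alloc, measureReal_def, Measure.prod_apply hs]
  exact (integral_toReal (measurable_measure_prodMk_left hs).aemeasurable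
    (ae_of_all _ fun ω => measure_lt_top _ _)).symm

lemma Protocol.alloc_nonneg (c : Fin n → ℝ) (i : Fin n) : 0 ≤ M.alloc f c i := measureReal_nonneg

open Classical in
/-- The price paid by the buyer. -/
noncomputable def Protocol.gross (M : Protocol n)
    (q : unitInterval × (Fin n → ℝ) × (Fin n → ℝ)) : ℝ :=
  ∑ i, if Buys (M.price q.1 q.2.2) q.2.1 i then (M.price q.1 q.2.2 i).toReal else 0

lemma Protocol.profit_eq (q : unitInterval × (Fin n → ℝ) × (Fin n → ℝ)) :
    M.profit q = M.gross q - ∑ i, M.pay q.2.2 i := rfl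

lemma Protocol.measurable_gross
    (hM : Measurable fun q : unitInterval × (Fin n → ℝ) => M.price q.1 q.2) :
    Measurable M.gross := by
  classical
  have hp : Measurable fun q : unitInterval × (Fin n → ℝ) × (Fin n → ℝ) => M.price q.1 q.2.2 :=
    hM.comp (measurable_fst.prodMk (measurable_snd.comp measurable_snd))
  refine Finset.measurable_fun_sum _ fun i _ => Measurable.ite ?_
    ((measurable_pi_apply i).comp hp).ereal_toReal measurable_const
  exact (hp.prodMk (measurable_fst.comp measurable_snd)) (measurableSet_buys i)

/-- A one-sided bound only, as prices may be very negative; it is what makes the transfers of a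
truthful protocol integrable. -/
lemma Protocol.gross_le (hM : ∀ ω c i, M.price ω c i ≠ ⊥)
    (q : unitInterval × (Fin n → ℝ) × (Fin n → ℝ)) : M.gross q ≤ ∑ i, |q.2.1 i| := by
  refine Finset.sum_le_sum fun i _ => ?_
  split_ifs with h
  · have h1 := EReal.toReal_le_toReal h.price_le (hM _ _ _) (EReal.coe_ne_top _)
    exact h1.trans (le_abs_self _)
  · exact abs_nonneg _

lemma measurePreserving_outcome_values (hf : ∀ i, IsNonnegDensity (f i))
    (hg : ∀ i, IsNonnegDensity (g i)) :
    MeasurePreserving (fun q : unitInterval × (Fin n → ℝ) × (Fin n → ℝ) => q.2.1)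
      (outcomeDist f g) (jointDist f) := by
  have := isProbabilityMeasure_jointDist hf
  have := isProbabilityMeasure_jointDist hg
  exact measurePreserving_fst.comp measurePreserving_snd

lemma measurePreserving_outcome_costs (hf : ∀ i, IsNonnegDensity (f i))
    (hg : ∀ i, IsNonnegDensity (g i)) :
    MeasurePreserving (fun q : unitInterval × (Fin n → ℝ) × (Fin n → ℝ) => q.2.2)
      (outcomeDist f g) (jointDist g) := by
  have := isProbabilityMeasure_jointDist hf
  have := isProbabilityMeasure_jointDist hg
  exact measurePreserving_snd.comp measurePreserving_snd

lemma measurePreserving_outcome_reorder (hf : ∀ i, IsNonnegDensity (f i))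
    (hg : ∀ i, IsNonnegDensity (g i)) :
    MeasurePreserving
      (fun q : (unitInterval × (Fin n → ℝ)) × (Fin n → ℝ) => (q.1.1, q.2, q.1.2))
      (((volume : Measure unitInterval).prod (jointDist g)).prod (jointDist f))
      (outcomeDist f g) := by
  have := isProbabilityMeasure_jointDist hf
  have := isProbabilityMeasure_jointDist hg
  exact ((MeasurePreserving.id volume).prod Measure.measurePreserving_swap).comp
    (measurePreserving_prodAssoc volume (jointDist g) (jointDist f))

lemma integrable_sum_abs_values (hf : ∀ i, IsNonnegDensity (f i))
    (hmean : ∀ i, Integrable fun z => z * f i z) (hg : ∀ i, IsNonnegDensity (g i)) :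
    Integrable (fun q : unitInterval × (Fin n → ℝ) × (Fin n → ℝ) => ∑ i, |q.2.1 i|)
      (outcomeDist f g) := by
  refine integrable_finsetSum _ fun i _ => ?_
  exact (measurePreserving_outcome_values hf hg).integrable_comp_of_integrable
    (integrable_eval_jointDist hf i (h := fun z => |z|) ((hf i).integrable_id (hmean i)).abs)

/-- The expected price paid by the buyer, by conditioning on seed and costs. -/
lemma Protocol.integral_gross (hf : ∀ i, IsNonnegDensity (f i))
    (hg : ∀ i, IsNonnegDensity (g i)) (hint : Integrable M.gross (outcomeDist f g)) :
    Integrable (fun s : unitInterval × (Fin n → ℝ) =>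
        ∑ i, saleProb f (M.price s.1 s.2) i * (M.price s.1 s.2 i).toReal)
      ((volume : Measure unitInterval).prod (jointDist g)) ∧
    ∫ q, M.gross q ∂outcomeDist f g =
      ∫ s : unitInterval × (Fin n → ℝ),
        ∑ i, saleProb f (M.price s.1 s.2) i * (M.price s.1 s.2 i).toReal
        ∂(volume : Measure unitInterval).prod (jointDist g) := by
  classical
  have := isProbabilityMeasure_jointDist hf
  have := isProbabilityMeasure_jointDist hg
  have hmp := measurePreserving_outcome_reorder hf hg
  have hint2 := hmp.integrable_comp_of_integrable hint
  have hinner : ∀ s : unitInterval × (Fin n → ℝ), ∫ v, M.gross (s.1, v, s.2) ∂jointDist f =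
      ∑ i, saleProb f (M.price s.1 s.2) i * (M.price s.1 s.2 i).toReal := by
    intro s
    have he : ∀ i, (fun v => if Buys (M.price s.1 s.2) v i then (M.price s.1 s.2 i).toReal else 0) =
        {v | Buys (M.price s.1 s.2) v i}.indicator fun _ => (M.price s.1 s.2 i).toReal := by
      intro i
      ext v
      by_cases h : Buys (M.price s.1 s.2) v i
      · rw [if_pos h, indicator_of_mem (by exact h)]
      · rw [if_neg h, indicator_of_notMem (by exact h)]
    simp only [Protocol.gross]
    rw [integral_finsetSum]
    · refine Finset.sum_congr rfl fun i _ => ?_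
      rw [he, integral_indicator_const _ (measurableSet_buys_right _ i)]
      rfl
    · intro i _
      rw [he]
      exact (integrable_const _).indicator (measurableSet_buys_right _ i)
  have h1 : ∫ q, M.gross q ∂outcomeDist f g =
      ∫ q : (unitInterval × (Fin n → ℝ)) × (Fin n → ℝ), M.gross (q.1.1, q.2, q.1.2)
        ∂((volume : Measure unitInterval).prod (jointDist g)).prod (jointDist f) := by
    conv_lhs => rw [← hmp.map_eq]
    exact integral_map hmp.measurable.aemeasurable (hmp.map_eq.symm ▸ hint.1)
  constructor
  · refine hint2.integral_prod_left.congr (ae_of_all _ fun s => ?_)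
    exact hinner s
  · rw [h1]
    refine (integral_prod _ hint2).trans (integral_congr_ae (ae_of_all _ fun s => ?_))
    exact hinner s

/-- The expected virtual cost of the items sold, by conditioning on seed and costs. -/
lemma Protocol.integral_virtualCost (hf : ∀ i, IsNonnegDensity (f i))
    (hg : ∀ i, IsNonnegDensity (g i))
    (hM : Measurable fun q : unitInterval × (Fin n → ℝ) => M.price q.1 q.2) (i : Fin n)
    (hint : Integrable (fun c => M.alloc f c i * virtualCost (g i) (c i)) (jointDist g)) :
    Integrable (fun s : unitInterval × (Fin n → ℝ) =>
        saleProb f (M.price s.1 s.2) i * virtualCost (g i) (s.2 i))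
      ((volume : Measure unitInterval).prod (jointDist g)) ∧
    ∫ c, M.alloc f c i * virtualCost (g i) (c i) ∂jointDist g =
      ∫ s : unitInterval × (Fin n → ℝ), saleProb f (M.price s.1 s.2) i * virtualCost (g i) (s.2 i)
        ∂(volume : Measure unitInterval).prod (jointDist g) := by
  have := isProbabilityMeasure_jointDist hf
  have := isProbabilityMeasure_jointDist hg
  have hθ : Measurable fun c : Fin n → ℝ => virtualCost (g i) (c i) :=
    (hg i).measurable_virtualCost.comp (measurable_pi_apply i)
  have hx : Measurable fun s : unitInterval × (Fin n → ℝ) => saleProb f (M.price s.1 s.2) i :=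
    (measurable_saleProb hf i).comp hM
  have hbd : ∀ c, Integrable fun ω => saleProb f (M.price ω c) i := fun c =>
    Integrable.of_bound (hx.comp measurable_prodMk_right).aestronglyMeasurable 1
      (ae_of_all _ fun ω => by
        rw [Real.norm_of_nonneg (saleProb_nonneg _ _)]; exact measureReal_le_one)
  have hI : Integrable (fun s : unitInterval × (Fin n → ℝ) =>
        saleProb f (M.price s.1 s.2) i * virtualCost (g i) (s.2 i))
      ((volume : Measure unitInterval).prod (jointDist g)) := by
    have hm : Measurable fun s : unitInterval × (Fin n → ℝ) =>
        saleProb f (M.price s.1 s.2) i * virtualCost (g i) (s.2 i) :=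
      hx.mul (hθ.comp measurable_snd)
    rw [integrable_prod_iff' hm.aestronglyMeasurable]
    refine ⟨ae_of_all _ fun c => (hbd c).mul_const (virtualCost (g i) (c i)), hint.norm.congr (ae_of_all _ fun c => ?_)⟩
    simp only [norm_mul, integral_mul_const, Real.norm_of_nonneg (saleProb_nonneg _ _),
      Real.norm_of_nonneg (Protocol.alloc_nonneg _ _), ← Protocol.alloc_eq_integral hf hM]
  refine ⟨hI, ?_⟩
  rw [integral_prod_symm _ hI]
  refine integral_congr_ae (ae_of_all _ fun c => ?_)
  simp only [integral_mul_const, Protocol.alloc_eq_integral hf hM]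

/-- The revenue is the expected profit of the posted prices at the virtual costs, up to the
difference between transfers and virtual costs. -/
lemma Protocol.revenue_eq (hf : ∀ i, IsNonnegDensity (f i))
    (hg : ∀ i, IsNonnegDensity (g i))
    (hM : Measurable fun q : unitInterval × (Fin n → ℝ) => M.price q.1 q.2)
    (hgross : Integrable M.gross (outcomeDist f g))
    (hpay : ∀ i, Integrable (fun c => M.pay c i) (jointDist g))
    (hcost : ∀ i, Integrable (fun c => M.alloc f c i * virtualCost (g i) (c i)) (jointDist g)) :
    Integrable (fun s : unitInterval × (Fin n → ℝ) =>
        pricingProfit f (fun i => virtualCost (g i) (s.2 i)) (M.price s.1 s.2))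
      ((volume : Measure unitInterval).prod (jointDist g)) ∧
    M.revenue f g = ∫ s : unitInterval × (Fin n → ℝ),
        pricingProfit f (fun i => virtualCost (g i) (s.2 i)) (M.price s.1 s.2)
        ∂(volume : Measure unitInterval).prod (jointDist g) +
      ∑ i, (∫ c, M.alloc f c i * virtualCost (g i) (c i) ∂jointDist g -
        ∫ c, M.pay c i ∂jointDist g) := by
  have hmc := measurePreserving_outcome_costs hf hg
  obtain ⟨h1, h2⟩ := Protocol.integral_gross hf hg hgross
  have h3 := fun i => Protocol.integral_virtualCost hf hg hM i (hcost i)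
  have hsum := integrable_finsetSum Finset.univ fun i _ => (h3 i).1
  have he : (fun s : unitInterval × (Fin n → ℝ) =>
        pricingProfit f (fun i => virtualCost (g i) (s.2 i)) (M.price s.1 s.2)) =
      fun s => ∑ i, saleProb f (M.price s.1 s.2) i * (M.price s.1 s.2 i).toReal -
        ∑ i, saleProb f (M.price s.1 s.2) i * virtualCost (g i) (s.2 i) := by
    ext s
    simp only [pricingProfit, mul_sub, Finset.sum_sub_distrib]
  have hpo : ∀ i, Integrable (fun q : unitInterval × (Fin n → ℝ) × (Fin n → ℝ) => M.pay q.2.2 i)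
      (outcomeDist f g) := fun i => hmc.integrable_comp_of_integrable (hpay i)
  have hpi : ∀ i, ∫ q, M.pay q.2.2 i ∂outcomeDist f g = ∫ c, M.pay c i ∂jointDist g := by
    intro i
    conv_rhs => rw [← hmc.map_eq]
    exact (integral_map hmc.measurable.aemeasurable (hmc.map_eq.symm ▸ (hpay i).1)).symm
  rw [he]
  refine ⟨h1.sub hsum, ?_⟩
  rw [integral_sub h1 hsum, ← h2, integral_finsetSum _ fun i _ => (h3 i).1,
    Finset.sum_sub_distrib, Protocol.revenue]
  simp only [Protocol.profit_eq]
  rw [integral_sub hgross (integrable_finsetSum _ fun i _ => hpo i),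
    integral_finsetSum _ fun i _ => hpo i]
  simp only [hpi, (h3 _).2]
  ring

end Protocols

/-! ### Truthful protocols -/

section Truthful

variable {n : ℕ} {f g : Fin n → ℝ → ℝ} {M : Protocol n}

lemma forall_update_mem_supp {c : Fin n → ℝ} (hc : ∀ j, c j ∈ supp (g j)) {i : Fin n} {a : ℝ}
    (ha : a ∈ supp (g i)) (j : Fin n) : Function.update c i a j ∈ supp (g j) := by
  by_cases hj : j = i
  · subst hj; rwa [Function.update_self]
  · rw [Function.update_of_ne hj]; exact hc j

lemma Protocol.IsTruthful.cost_le_pay (hg : ∀ i, IsNonnegDensity (g i))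
    (hM : M.IsTruthful f g) {c : Fin n → ℝ} (hc : ∀ j, c j ∈ supp (g j)) (i : Fin n) :
    0 ≤ M.alloc f c i * c i ∧ M.alloc f c i * c i ≤ M.pay c i :=
  ⟨mul_nonneg (Protocol.alloc_nonneg _ _) ((hg i).nonneg_of_mem_supp (hc i)),
    sub_nonneg.1 (hM.participation c hc i)⟩

/-- The transfer to a seller covers his cost and his information rent. -/
lemma Protocol.IsTruthful.cost_add_rent_le (hg : ∀ i, IsNonnegDensity (g i))
    (hM : M.IsTruthful f g) {c : Fin n → ℝ} (hc : ∀ j, c j ∈ supp (g j)) (i : Fin n) :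
    ENNReal.ofReal (M.alloc f c i * c i) + ∫⁻ u in supp (g i) ∩ Ioi (c i),
      ENNReal.ofReal (M.alloc f (Function.update c i u) i) ≤ ENNReal.ofReal (M.pay c i) := by
  obtain ⟨h0, h1⟩ := hM.cost_le_pay hg hc i
  have h2 := lintegral_le_of_dominant (S := supp (g i))
    (U := fun a => M.sellerUtility f i a (Function.update c i a))
    (y := fun a => M.alloc f (Function.update c i a) i) (hg i).ordConnected
    (fun a ha => by
      simpa using hM.participation _ (forall_update_mem_supp hc ha) i)
    (fun a => Protocol.alloc_nonneg _ _)
    (fun a ha b hb => by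
      have := hM.dominant _ (forall_update_mem_supp hc ha) i b hb
      simp only [Function.update_self, Function.update_idem, Protocol.sellerUtility] at this ⊢
      linarith) (hc i)
  simp only [Function.update_eq_self, Protocol.sellerUtility] at h2
  calc _ ≤ ENNReal.ofReal (M.alloc f c i * c i) +
        ENNReal.ofReal (M.pay c i - M.alloc f c i * c i) := by gcongr
    _ = ENNReal.ofReal (M.pay c i) := by
        rw [← ENNReal.ofReal_add h0 (sub_nonneg.2 h1), add_sub_cancel]

/-- Transfers are almost surely nonnegative, so each is at most their sum, which is the buyer's
payment minus the profit and hence at most `∑ |v_j|` minus the integrable profit. -/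
lemma Protocol.IsTruthful.integrable_pay (hf : ∀ i, IsNonnegDensity (f i))
    (hmean : ∀ i, Integrable fun z => z * f i z) (hg : ∀ i, IsNonnegDensity (g i))
    (hM : M.IsTruthful f g) (i : Fin n) : Integrable (fun c => M.pay c i) (jointDist g) := by
  have hmc := measurePreserving_outcome_costs hf hg
  have hm : ∀ j, Measurable fun c => M.pay c j := fun j =>
    (measurable_pi_apply j).comp hM.measurable_pay
  rw [← hmc.integrable_comp (hm i).aestronglyMeasurable]
  refine ((integrable_sum_abs_values hf hmean hg).sub hM.integrable_profit).mono'
    ((hm i).comp hmc.measurable).aestronglyMeasurable ?_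
  filter_upwards [hmc.quasiMeasurePreserving.ae (ae_forall_mem_supp hg)] with q hq
  have h0 : ∀ j, 0 ≤ M.pay q.2.2 j := fun j =>
    (hM.cost_le_pay hg hq j).1.trans (hM.cost_le_pay hg hq j).2
  have h1 := Finset.single_le_sum (fun j _ => h0 j) (Finset.mem_univ i)
  have h2 := Protocol.gross_le hM.price_ne_bot q
  simp only [Function.comp_apply, Pi.sub_apply, Protocol.profit_eq]
  rw [Real.norm_of_nonneg (h0 i)]
  linarith

lemma Protocol.IsTruthful.integrable_gross (hf : ∀ i, IsNonnegDensity (f i))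
    (hmean : ∀ i, Integrable fun z => z * f i z) (hg : ∀ i, IsNonnegDensity (g i))
    (hM : M.IsTruthful f g) : Integrable M.gross (outcomeDist f g) := by
  have hmc := measurePreserving_outcome_costs hf hg
  have h1 : Integrable (fun q : unitInterval × (Fin n → ℝ) × (Fin n → ℝ) => ∑ i, M.pay q.2.2 i)
      (outcomeDist f g) := integrable_finsetSum _ fun i _ =>
    hmc.integrable_comp_of_integrable (hM.integrable_pay hf hmean hg i)
  refine (hM.integrable_profit.add h1).congr (ae_of_all _ fun q => ?_)
  simp [Protocol.profit_eq]

/-- The expected transfer to a seller is at least the expected virtual cost. -/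
lemma Protocol.IsTruthful.virtualCost_le_pay (hf : ∀ i, IsNonnegDensity (f i))
    (hmean : ∀ i, Integrable fun z => z * f i z) (hg : ∀ i, IsNonnegDensity (g i))
    (hM : M.IsTruthful f g) (i : Fin n) :
    Integrable (fun c => M.alloc f c i * virtualCost (g i) (c i)) (jointDist g) ∧
    ∫ c, M.alloc f c i * virtualCost (g i) (c i) ∂jointDist g ≤
      ∫ c, M.pay c i ∂jointDist g := by
  have hpay := hM.integrable_pay hf hmean hg i
  have hx := Protocol.measurable_alloc hf hM.measurable_price i
  have hm : Measurable fun c : Fin n → ℝ => M.alloc f c i * virtualCost (g i) (c i) :=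
    hx.mul ((hg i).measurable_virtualCost.comp (measurable_pi_apply i))
  have h0 : ∀ᵐ c ∂jointDist g, 0 ≤ M.alloc f c i * virtualCost (g i) (c i) := by
    filter_upwards [ae_forall_mem_supp hg] with c hc
    exact mul_nonneg (Protocol.alloc_nonneg _ _)
      (((hg i).nonneg_of_mem_supp (hc i)).trans ((hg i).le_virtualCost _))
  have h1 : ∀ᵐ c ∂jointDist g, 0 ≤ M.pay c i := by
    filter_upwards [ae_forall_mem_supp hg] with c hc
    exact (hM.cost_le_pay hg hc i).1.trans (hM.cost_le_pay hg hc i).2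
  have h2 : ∫⁻ c, ENNReal.ofReal (M.alloc f c i * virtualCost (g i) (c i)) ∂jointDist g ≤
      ∫⁻ c, ENNReal.ofReal (M.pay c i) ∂jointDist g := by
    rw [← lintegral_cost_add_rent hg hx (fun c => Protocol.alloc_nonneg c i) i]
    refine lintegral_mono_ae ((ae_forall_mem_supp hg).mono fun c hc => ?_)
    exact hM.cost_add_rent_le hg hc i
  have h3 := (hasFiniteIntegral_iff_ofReal h1).1 hpay.2
  refine ⟨⟨hm.aestronglyMeasurable, (hasFiniteIntegral_iff_ofReal h0).2 (h2.trans_lt h3)⟩, ?_⟩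
  rw [integral_eq_lintegral_of_nonneg_ae h0 hm.aestronglyMeasurable,
    integral_eq_lintegral_of_nonneg_ae h1 hpay.1]
  exact ENNReal.toReal_mono h3.ne h2

end Truthful

/-! ### The anonymous virtual reserve mechanism -/

section Mechanism

variable {n : ℕ} {f g : Fin n → ℝ → ℝ}

lemma measurable_mechPrices (hf : ∀ i, IsNonnegDensity (f i))
    (hreg : ∀ i, StrictMonoOn (virtualValue (f i)) (supp (f i)))
    (hg : ∀ i, IsNonnegDensity (g i)) : Measurable (mechPrices f g) := by
  have hθ : ∀ i, Measurable fun c : Fin n → ℝ => virtualCost (g i) (c i) := fun i =>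
    (hg i).measurable_virtualCost.comp (measurable_pi_apply i)
  refine measurable_pi_iff.2 fun i => ?_
  exact monotone_virtualValueInv.measurable.comp
    (((continuous_virtualReserve hf hreg).measurable.comp (measurable_pi_iff.2 hθ)).add (hθ i))

lemma reserveMechanism_alloc (hf : ∀ i, IsNonnegDensity (f i))
    (hreg : ∀ i, StrictMonoOn (virtualValue (f i)) (supp (f i)))
    (hg : ∀ i, IsNonnegDensity (g i)) (c : Fin n → ℝ) (i : Fin n) :
    (reserveMechanism f g).alloc f c i = saleProb f (mechPrices f g c) i := by
  rw [Protocol.alloc_eq_integral hf ((measurable_mechPrices hf hreg hg).comp measurable_snd)]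
  simp [reserveMechanism]

lemma measurable_saleProb_mech (hf : ∀ i, IsNonnegDensity (f i))
    (hreg : ∀ i, StrictMonoOn (virtualValue (f i)) (supp (f i)))
    (hg : ∀ i, IsNonnegDensity (g i)) (i : Fin n) :
    Measurable fun c => saleProb f (mechPrices f g c) i :=
  (measurable_saleProb hf i).comp (measurable_mechPrices hf hreg hg)

/-- Items are priced above cost. -/
lemma saleProb_mech_le (hf : ∀ i, IsNonnegDensity (f i))
    (hreg : ∀ i, StrictMonoOn (virtualValue (f i)) (supp (f i)))
    (hg : ∀ i, IsNonnegDensity (g i)) (c : Fin n → ℝ) (i : Fin n) :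
    saleProb f (mechPrices f g c) i ≤ (dist (f i)).real {v | c i ≤ v} := by
  have := isProbabilityMeasure_jointDist hf
  rw [← (measurePreserving_eval_jointDist hf i).measureReal_preimage
    (show MeasurableSet {v | c i ≤ v} from measurableSet_Ici).nullMeasurableSet]
  refine measureReal_mono fun v hv => ?_
  have h1 : mechPrices f g c i ≤ v i := Buys.price_le hv
  set θ := fun i => virtualCost (g i) (c i) with hθ
  have h2 : ((virtualReserve f θ + θ i : ℝ) : EReal) ≤ v i :=
    ((hf i).le_virtualValueInv_self _).trans h1
  have h3 := EReal.coe_le_coe_iff.1 h2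
  have h4 := (virtualReserve_mem hf hreg θ).1
  have h5 : c i ≤ θ i := (hg i).le_virtualCost (c i)
  show c i ≤ v i
  linarith

lemma antitoneOn_saleProb_mech (hf : ∀ i, IsNonnegDensity (f i))
    (hreg : ∀ i, StrictMonoOn (virtualValue (f i)) (supp (f i)))
    (hg : ∀ i, IsNonnegDensity (g i)) (hMHR : ∀ i, HasMHR fun z => g i (-z))
    (c : Fin n → ℝ) (i : Fin n) :
    AntitoneOn (fun u => saleProb f (mechPrices f g (Function.update c i u)) i)
      (supp (g i)) := by
  intro a ha b hb hab
  set θ := fun j => virtualCost (g j) (Function.update c i a j) with hθ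
  have h1 := saleProb_update_le hf hreg θ i (virtualCost (g i) b)
    (by simpa [hθ] using (hg i).monotoneOn_virtualCost (hMHR i) ha hb hab)
  have h2 : Function.update θ i (virtualCost (g i) b) =
      fun j => virtualCost (g j) (Function.update c i b j) := by
    ext j
    by_cases hj : j = i
    · subst hj; simp
    · simp [hθ, Function.update_of_ne hj]
  rw [h2] at h1
  exact h1

/-- A sale at report `u` requires `v_i ≥ u`, and the tail probabilities of `v_i` integrate to its
mean. Rents are therefore finite even for unbounded costs. -/
lemma lintegral_saleProb_mech_le (hf : ∀ i, IsNonnegDensity (f i))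
    (hmean : ∀ i, Integrable fun z => z * f i z)
    (hreg : ∀ i, StrictMonoOn (virtualValue (f i)) (supp (f i)))
    (hg : ∀ i, IsNonnegDensity (g i)) (c : Fin n → ℝ) (i : Fin n) :
    ∫⁻ u in supp (g i), ENNReal.ofReal (saleProb f (mechPrices f g (Function.update c i u)) i) ≤
      ENNReal.ofReal (∫ v, v ∂dist (f i)) := by
  have := (hf i).isProbabilityMeasure
  rw [ofReal_integral_eq_lintegral_ofReal ((hf i).integrable_id (hmean i)) (hf i).ae_nonneg,
    lintegral_eq_lintegral_meas_le _ (hf i).ae_nonneg measurable_id.aemeasurable]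
  rw [setLIntegral_congr (Ioi_ae_eq_Ici (a := (0 : ℝ)))]
  refine (lintegral_mono fun u => ?_).trans
    (lintegral_mono_set (fun u hu => (hg i).nonneg_of_mem_supp hu))
  refine ENNReal.ofReal_le_of_le_toReal ?_
  have := saleProb_mech_le hf hreg hg (Function.update c i u) i
  rwa [Function.update_self] at this

lemma integrableOn_saleProb_mech (hf : ∀ i, IsNonnegDensity (f i))
    (hmean : ∀ i, Integrable fun z => z * f i z)
    (hreg : ∀ i, StrictMonoOn (virtualValue (f i)) (supp (f i)))
    (hg : ∀ i, IsNonnegDensity (g i)) (c : Fin n → ℝ) (i : Fin n) :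
    IntegrableOn (fun u => saleProb f (mechPrices f g (Function.update c i u)) i)
      (supp (g i)) := by
  refine ⟨((measurable_saleProb_mech hf hreg hg i).comp
    ((measurable_update_prod i).comp measurable_prodMk_left)).aestronglyMeasurable, ?_⟩
  rw [hasFiniteIntegral_iff_ofReal (ae_of_all _ fun u => saleProb_nonneg _ _)]
  exact (lintegral_saleProb_mech_le hf hmean hreg hg c i).trans_lt ENNReal.ofReal_lt_top

lemma ofReal_integral_saleProb_mech (hf : ∀ i, IsNonnegDensity (f i))
    (hmean : ∀ i, Integrable fun z => z * f i z)
    (hreg : ∀ i, StrictMonoOn (virtualValue (f i)) (supp (f i)))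
    (hg : ∀ i, IsNonnegDensity (g i)) (c : Fin n → ℝ) (i : Fin n) :
    ENNReal.ofReal (∫ u in supp (g i) ∩ Ioi (c i),
      saleProb f (mechPrices f g (Function.update c i u)) i) =
    ∫⁻ u in supp (g i) ∩ Ioi (c i),
      ENNReal.ofReal (saleProb f (mechPrices f g (Function.update c i u)) i) :=
  ofReal_integral_eq_lintegral_ofReal
    ((integrableOn_saleProb_mech hf hmean hreg hg c i).mono_set inter_subset_left)
    (ae_of_all _ fun _ => saleProb_nonneg _ _)

/-- The division by the sale probability cancels. If that probability is zero, so is the rent, since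
the probability stays zero at higher reports. -/
lemma reserveMechanism_pay (hf : ∀ i, IsNonnegDensity (f i))
    (hreg : ∀ i, StrictMonoOn (virtualValue (f i)) (supp (f i)))
    (hg : ∀ i, IsNonnegDensity (g i)) (hMHR : ∀ i, HasMHR fun z => g i (-z))
    {c : Fin n → ℝ} {i : Fin n} (hc : c i ∈ supp (g i)) :
    (reserveMechanism f g).pay c i = saleProb f (mechPrices f g c) i * c i +
      ∫ u in supp (g i) ∩ Ioi (c i), saleProb f (mechPrices f g (Function.update c i u)) i := by
  simp only [reserveMechanism, sellerPrice]
  rcases eq_or_ne (saleProb f (mechPrices f g c) i) 0 with h0 | h0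
  · have : ∫ u in supp (g i) ∩ Ioi (c i),
        saleProb f (mechPrices f g (Function.update c i u)) i = 0 := by
      refine setIntegral_eq_zero_of_forall_eq_zero fun u hu => ?_
      have := antitoneOn_saleProb_mech hf hreg hg hMHR c i hc hu.1 (le_of_lt hu.2)
      simp only [Function.update_eq_self, h0] at this
      exact le_antisymm this (saleProb_nonneg _ _)
    rw [h0, this]
    simp
  · rw [mul_add, mul_div_cancel₀ _ h0]

lemma measurable_reserveMechanism_pay (hf : ∀ i, IsNonnegDensity (f i))
    (hmean : ∀ i, Integrable fun z => z * f i z)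
    (hreg : ∀ i, StrictMonoOn (virtualValue (f i)) (supp (f i)))
    (hg : ∀ i, IsNonnegDensity (g i)) : Measurable (reserveMechanism f g).pay := by
  refine measurable_pi_iff.2 fun i => ?_
  have hx := measurable_saleProb_mech hf hreg hg i
  have hJ : Measurable fun c : Fin n → ℝ => ∫ u in supp (g i) ∩ Ioi (c i),
      saleProb f (mechPrices f g (Function.update c i u)) i := by
    have h := (measurable_rent hg hx i).ennreal_toReal
    refine (congrArg Measurable (funext fun c => ?_)).mp h
    rw [← ofReal_integral_saleProb_mech hf hmean hreg hg, ENNReal.toReal_ofReal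
      (integral_nonneg fun _ => saleProb_nonneg _ _)]
  exact hx.mul ((measurable_pi_apply i).add (hJ.div hx))

/-- Markov's inequality bounds the cost term by `E v_i`, and the tail integral bounds the rent by
another `E v_i`. -/
lemma reserveMechanism_pay_bounds (hf : ∀ i, IsNonnegDensity (f i))
    (hmean : ∀ i, Integrable fun z => z * f i z)
    (hreg : ∀ i, StrictMonoOn (virtualValue (f i)) (supp (f i)))
    (hg : ∀ i, IsNonnegDensity (g i)) (hMHR : ∀ i, HasMHR fun z => g i (-z))
    {c : Fin n → ℝ} {i : Fin n} (hc : c i ∈ supp (g i)) :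
    0 ≤ (reserveMechanism f g).pay c i ∧
      (reserveMechanism f g).pay c i ≤ ∫ v, v ∂dist (f i) + ∫ v, v ∂dist (f i) := by
  have := (hf i).isProbabilityMeasure
  have hE : 0 ≤ ∫ v, v ∂dist (f i) := integral_nonneg_of_ae (hf i).ae_nonneg
  have hc0 := (hg i).nonneg_of_mem_supp hc
  rw [reserveMechanism_pay hf hreg hg hMHR hc]
  constructor
  · exact add_nonneg (mul_nonneg (saleProb_nonneg _ _) hc0)
      (integral_nonneg fun _ => saleProb_nonneg _ _)
  · refine add_le_add ?_ ?_
    · have h1 := mul_meas_ge_le_integral_of_nonneg (hf i).ae_nonneg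
        ((hf i).integrable_id (hmean i)) (c i)
      have h2 := mul_le_mul_of_nonneg_left (saleProb_mech_le hf hreg hg c i) hc0
      rw [mul_comm]
      exact h2.trans h1
    · rw [← ENNReal.ofReal_le_ofReal_iff hE, ofReal_integral_saleProb_mech hf hmean hreg hg]
      exact (lintegral_mono_set inter_subset_left).trans
        (lintegral_saleProb_mech_le hf hmean hreg hg c i)

lemma integrable_reserveMechanism_pay (hf : ∀ i, IsNonnegDensity (f i))
    (hmean : ∀ i, Integrable fun z => z * f i z)
    (hreg : ∀ i, StrictMonoOn (virtualValue (f i)) (supp (f i)))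
    (hg : ∀ i, IsNonnegDensity (g i)) (hMHR : ∀ i, HasMHR fun z => g i (-z)) (i : Fin n) :
    Integrable (fun c => (reserveMechanism f g).pay c i) (jointDist g) := by
  have := isProbabilityMeasure_jointDist hg
  refine Integrable.of_bound ((measurable_pi_apply i).comp
    (measurable_reserveMechanism_pay hf hmean hreg hg)).aestronglyMeasurable
    (∫ v, v ∂dist (f i) + ∫ v, v ∂dist (f i)) ?_
  filter_upwards [ae_forall_mem_supp hg] with c hc
  obtain ⟨h1, h2⟩ := reserveMechanism_pay_bounds hf hmean hreg hg hMHR (hc i)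
  rwa [Real.norm_of_nonneg h1]

lemma mechPrices_nonneg (hf : ∀ i, IsNonnegDensity (f i)) (c : Fin n → ℝ) (i : Fin n) :
    0 ≤ mechPrices f g c i := (hf i).virtualValueInv_nonneg _

lemma integrable_reserveMechanism_gross (hf : ∀ i, IsNonnegDensity (f i))
    (hmean : ∀ i, Integrable fun z => z * f i z)
    (hreg : ∀ i, StrictMonoOn (virtualValue (f i)) (supp (f i)))
    (hg : ∀ i, IsNonnegDensity (g i)) :
    Integrable (reserveMechanism f g).gross (outcomeDist f g) := by
  refine (integrable_sum_abs_values hf hmean hg).mono' (Protocol.measurable_gross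
    ((measurable_mechPrices hf hreg hg).comp measurable_snd)).aestronglyMeasurable
    (ae_of_all _ fun q => ?_)
  rw [Real.norm_of_nonneg]
  · exact Protocol.gross_le (fun _ c i => reservePrices_ne_bot hf _ i) q
  · refine Finset.sum_nonneg fun i _ => ?_
    split_ifs
    · exact EReal.toReal_nonneg (mechPrices_nonneg hf _ i)
    · exact le_rfl

theorem reserveMechanism_isTruthful (hf : ∀ i, IsNonnegDensity (f i))
    (hmean : ∀ i, Integrable fun z => z * f i z)
    (hreg : ∀ i, StrictMonoOn (virtualValue (f i)) (supp (f i)))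
    (hg : ∀ i, IsNonnegDensity (g i)) (hMHR : ∀ i, HasMHR fun z => g i (-z)) :
    (reserveMechanism f g).IsTruthful f g where
  measurable_price := (measurable_mechPrices hf hreg hg).comp measurable_snd
  measurable_pay := measurable_reserveMechanism_pay hf hmean hreg hg
  price_ne_bot _ _ i := reservePrices_ne_bot hf _ i
  integrable_profit := by
    have hmc := measurePreserving_outcome_costs hf hg
    exact (integrable_reserveMechanism_gross hf hmean hreg hg).sub
      (integrable_finsetSum _ fun i _ => hmc.integrable_comp_of_integrable
        (integrable_reserveMechanism_pay hf hmean hreg hg hMHR i))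
  dominant c hc i b hb := by
    have h := rent_add_le (S := supp (g i)) (hg i).ordConnected (antitoneOn_saleProb_mech hf hreg hg hMHR c i)
      (integrableOn_saleProb_mech hf hmean hreg hg c i) (hc i) hb
    simp only [Protocol.sellerUtility, reserveMechanism_alloc hf hreg hg]
    rw [reserveMechanism_pay hf hreg hg hMHR (hc i), reserveMechanism_pay hf hreg hg hMHR
      (c := Function.update c i b) (by simpa using hb)]
    simp only [Function.update_self, Function.update_idem]
    linarith
  participation c hc i := by
    simp only [Protocol.sellerUtility, reserveMechanism_alloc hf hreg hg]
    rw [reserveMechanism_pay hf hreg hg hMHR (hc i), add_sub_cancel_left]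
    exact integral_nonneg fun _ => saleProb_nonneg _ _

/-- The expected transfers of the mechanism are the expected virtual costs. -/
lemma reserveMechanism_pay_le_virtualCost (hf : ∀ i, IsNonnegDensity (f i))
    (hmean : ∀ i, Integrable fun z => z * f i z)
    (hreg : ∀ i, StrictMonoOn (virtualValue (f i)) (supp (f i)))
    (hg : ∀ i, IsNonnegDensity (g i)) (hMHR : ∀ i, HasMHR fun z => g i (-z)) (i : Fin n) :
    ∫ c, (reserveMechanism f g).pay c i ∂jointDist g ≤
      ∫ c, (reserveMechanism f g).alloc f c i * virtualCost (g i) (c i) ∂jointDist g := by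
  have hx := measurable_saleProb_mech hf hreg hg i
  have hcost := ((reserveMechanism_isTruthful hf hmean hreg hg hMHR).virtualCost_le_pay
    hf hmean hg i).1
  simp only [reserveMechanism_alloc hf hreg hg] at hcost ⊢
  have h0 : ∀ᵐ c ∂jointDist g,
      0 ≤ saleProb f (mechPrices f g c) i * virtualCost (g i) (c i) := by
    filter_upwards [ae_forall_mem_supp hg] with c hc
    exact mul_nonneg (saleProb_nonneg _ _)
      (((hg i).nonneg_of_mem_supp (hc i)).trans ((hg i).le_virtualCost _))
  have h1 : ∀ᵐ c ∂jointDist g, 0 ≤ (reserveMechanism f g).pay c i := by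
    filter_upwards [ae_forall_mem_supp hg] with c hc
    exact (reserveMechanism_pay_bounds hf hmean hreg hg hMHR (hc i)).1
  rw [integral_eq_lintegral_of_nonneg_ae h0 hcost.1, integral_eq_lintegral_of_nonneg_ae h1
    (integrable_reserveMechanism_pay hf hmean hreg hg hMHR i).1]
  refine ENNReal.toReal_mono ((hasFiniteIntegral_iff_ofReal h0).1 hcost.2).ne ?_
  rw [← lintegral_cost_add_rent hg hx (fun c => saleProb_nonneg _ i) i]
  refine lintegral_mono_ae ((ae_forall_mem_supp hg).mono fun c hc => ?_)
  rw [reserveMechanism_pay hf hreg hg hMHR (hc i),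
    ← ofReal_integral_saleProb_mech hf hmean hreg hg]
  -- Subadditivity suffices, as only this direction is claimed.
  exact ENNReal.ofReal_add_le

theorem reserveMechanism_isApproximation (hf : ∀ i, IsNonnegDensity (f i))
    (hmean : ∀ i, Integrable fun z => z * f i z)
    (hreg : ∀ i, StrictMonoOn (virtualValue (f i)) (supp (f i)))
    (hg : ∀ i, IsNonnegDensity (g i)) (hMHR : ∀ i, HasMHR fun z => g i (-z)) :
    (reserveMechanism f g).IsApproximation f g (1 / 2) := by
  have hT := reserveMechanism_isTruthful hf hmean hreg hg hMHR
  refine ⟨hT, fun M hM => ?_⟩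
  have hrev : ∀ {M : Protocol n}, M.IsTruthful f g → _ := fun {M} hM =>
    Protocol.revenue_eq hf hg hM.measurable_price (hM.integrable_gross hf hmean hg)
      (hM.integrable_pay hf hmean hg) (fun i => (hM.virtualCost_le_pay hf hmean hg i).1)
  obtain ⟨h1, h2⟩ := hrev hM
  obtain ⟨h3, h4⟩ := hrev hT
  have h5 : ∑ i, (∫ c, M.alloc f c i * virtualCost (g i) (c i) ∂jointDist g -
      ∫ c, M.pay c i ∂jointDist g) ≤ 0 :=
    Finset.sum_nonpos fun i _ => sub_nonpos.2 (hM.virtualCost_le_pay hf hmean hg i).2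
  have h6 : 0 ≤ ∑ i, (∫ c, (reserveMechanism f g).alloc f c i * virtualCost (g i) (c i)
      ∂jointDist g - ∫ c, (reserveMechanism f g).pay c i ∂jointDist g) :=
    Finset.sum_nonneg fun i _ => sub_nonneg.2
      (reserveMechanism_pay_le_virtualCost hf hmean hreg hg hMHR i)
  -- The pricing bound at each fixed seed and cost vector; this also covers randomized protocols.
  have h7 := integral_mono (h1.const_mul (1 / 2)) h3 fun s =>
    half_mul_pricingProfit_le hf hmean hreg (fun i => virtualCost (g i) (s.2 i))
      (M.price s.1 s.2) (hM.price_ne_bot _ _)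
  rw [integral_const_mul] at h7
  rw [h2, h4]
  linarith

end Mechanism

end Intermediation

theorem mainTheorem6 (n : ℕ)
    -- densities of the values and of the costs
    (f g : Fin n → ℝ → ℝ)
    (hf : ∀ i, Intermediation.IsNonnegDensity (f i))
    -- finite mean and strict regularity of the values
    (hmean : ∀ i, Integrable fun z => z * f i z)
    (hreg : ∀ i, StrictMonoOn (Intermediation.virtualValue (f i)) (Intermediation.supp (f i)))
    (hg : ∀ i, Intermediation.IsNonnegDensity (g i))
    -- the negated costs have monotone hazard rates
    (hMHR : ∀ i, Intermediation.HasMHR fun z => g i (-z)) :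
    -- a half-approximation to the algorithmic pricing problem, for all item costs
    (∀ θ : Fin n → ℝ, ∀ p : Fin n → EReal, (∀ i, p i ≠ ⊥) →
      1 / 2 * Intermediation.pricingProfit f θ p ≤
        Intermediation.pricingProfit f θ (Intermediation.reservePrices f θ)) ∧
    -- monotonicity in the (virtual) cost of each seller
    (∀ θ : Fin n → ℝ, ∀ i, ∀ t, θ i ≤ t →
      Intermediation.saleProb f (Intermediation.reservePrices f (Function.update θ i t)) i ≤
        Intermediation.saleProb f (Intermediation.reservePrices f θ) i) ∧
    -- a half-approximation to the intermediation problem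
    (Intermediation.reserveMechanism f g).IsApproximation f g (1 / 2) :=
  ⟨Intermediation.half_mul_pricingProfit_le hf hmean hreg,
    Intermediation.saleProb_update_le hf hreg,
    Intermediation.reserveMechanism_isApproximation hf hmean hreg hg hMHR⟩
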